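/- **Conventions.** An encoding of a finite group $G$ assigns to its elements distinct bit strings of a common length $n$. Let $(G_i)_{i\in I}$ be a family of finite groups with encodings $e_i$ of lengths $n_i$. "Polynomial" means bounded by a fixed polynomial in $\log|G_i|$, for all $i$. The family is *efficiently encoded* if the lengths $n_i$ are polynomial and multiplication in $G_i$ is computed, on the codes of elements, by Boolean circuits of polynomial size. A function $F:\{0,1\}^{n_i}\to\{0,1\}^{m}$ *hides* a subgroup $L\le G_i$ if $g\mapsto F(e_i(g))$ is constant on each left coset of $L$ and takes distinct values on distinct left cosets (the values of $F$ on strings that encode no element are arbitrary). The family is *fully reconstructible in the encodings $e_i$* if for all polynomially bounded label lengths $m_i$ there are quantum circuits of polynomial size (counting qubits, gates, with each oracle query as one gate, and returned strings) with oracle access to a function $F:\{0,1\}^{n_i}\to\{0,1\}^{m_i}$ such that, whenever $F$ hides a subgroup $L\le G_i$, the $i$-th circuit returns, with probability at least $2/3$, codes of a list of elements that generates $L$. Hidden subgroups of the family $(G_i)$ are *fully reconstructible* if the family is fully reconstructible in all encodings in which it is efficiently encoded. **Theorem 5.** Let $(H_i)_{i\in I}$ be a family of groups, and let $(G_i)_{i\in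 I}$ be a family of finite groups with normal subgroups $K_i\lhd G_i$ and isomorphisms $G_i/K_i\cong H_i$, such that $|K_i|$ is bounded by a polynomial in $\log|H_i|$. 1. If hidden subgroups of the family $(H_i)$ are fully reconstructible, then hidden subgroups of the family $(G_i)$ are fully reconstructible. 2. More precisely, for fixed encodings: let $H_i$ be encoded by strings of polynomial length in $\log|H_i|$, let $(G_i)$ be efficiently encoded, and suppose that some transversals $t_i:H_i\to G_i$ of the left cosets of $K_i$ are computed in these encodings by Boolean circuits of polynomial size in $\log |G_i|$. If $(H_i)$ is fully reconstructible in its encodings, then $(G_i)$ is fully reconstructible in its encodings. -/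

import Mathlib

/-! ### Boolean circuits -/

/-- A Boolean circuit with `n` inputs and `m` outputs, as a straight-line program over the complete
basis `{NAND, constant 0}`. Wires `0, …, n - 1` carry the input and the `k`-th gate `(a, b)` writes
the NAND of wires `a` and `b` on wire `n + k`; a wire that is not yet written carries the
constant `0`. Output `j` is read from wire `out j`. -/
structure BoolCircuit (n m : ℕ) where
  gates : List (ℕ × ℕ)
  out : Fin m → ℕ

namespace BoolCircuit

/-- The values of all wires after the gates have been evaluated in order. -/
def wires (gates : List (ℕ × ℕ)) (w : List Bool) : List Bool :=
  gates.foldl (fun v g => v ++ [!(v.getD g.1 false && v.getD g.2 false)]) w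

/-- The Boolean function computed by the circuit. -/
def eval {n m : ℕ} (C : BoolCircuit n m) (x : Fin n → Bool) : Fin m → Bool :=
  fun j => (wires C.gates (List.ofFn x)).getD (C.out j) false

/-- The number of gates. -/
def size {n m : ℕ} (C : BoolCircuit n m) : ℕ := C.gates.length

end BoolCircuit

/-! ### Quantum circuits with oracle access -/

/-- A (pure) state of `N` qubits: its amplitudes in the computational basis. -/
abbrev QState (N : ℕ) : Type := (Fin N → Bool) → ℂ

/-- A gate on `N` qubits, with access to an oracle `{0,1}^n → {0,1}^m`: one of the finite universal
set Hadamard, `π/8` phase gate, NOT, CNOT, Toffoli (with equal controls allowed, in which case it is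
a CNOT), or one application of the oracle. -/
inductive QGate (N n m : ℕ) : Type
  | hadamard (a : Fin N)
  | phase (a : Fin N)
  | flip (a : Fin N)
  | cnot (a c : Fin N) (hac : a ≠ c)
  | toffoli (a b c : Fin N) (hac : a ≠ c) (hbc : b ≠ c)
  | oracle (x : Fin n ↪ Fin N) (y : Fin m ↪ Fin N) (hxy : ∀ k j, x k ≠ y j)

/-- Replace bit `a` of `s` by its XOR with `b`. -/
def xorBit {N : ℕ} (s : Fin N → Bool) (a : Fin N) (b : Bool) : Fin N → Bool :=
  Function.update s a (xor (s a) b)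

/-- The oracle on basis states: `|x⟩|y⟩ ↦ |x⟩|y ⊕ F x⟩` on the wires `x` and `y`. -/
def xorQuery {N n m : ℕ} (F : (Fin n → Bool) → (Fin m → Bool))
    (x : Fin n ↪ Fin N) (y : Fin m ↪ Fin N) (s : Fin N → Bool) : Fin N → Bool :=
  fun w => xor (s w) (decide (∃ j, y j = w ∧ F (fun k => s (x k)) j = true))

/-- The unitary action of a gate on states when the oracle is `F`. The last four kinds of gates
permute the basis states by an involution `σ`, so that they send the amplitude function `ψ`
to `ψ ∘ σ`. -/
noncomputable def QGate.apply {N n m : ℕ} (F : (Fin n → Bool) → (Fin m → Bool)) :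
    QGate N n m → QState N → QState N
  | .hadamard a, ψ => fun s =>
      (ψ (Function.update s a false) + (if s a then -1 else 1) * ψ (Function.update s a true))
        / (Real.sqrt 2 : ℂ)
  | .phase a, ψ => fun s =>
      (if s a then Complex.exp (Complex.I * (Real.pi / 4 : ℂ)) else 1) * ψ s
  | .flip a, ψ => fun s => ψ (xorBit s a true)
  | .cnot a c _, ψ => fun s => ψ (xorBit s c (s a))
  | .toffoli a b c _ _, ψ => fun s => ψ (xorBit s c (s a && s b))
  | .oracle x y _, ψ => fun s => ψ (xorQuery F x y s)

/-- A quantum circuit with access to an oracle `{0,1}^n → {0,1}^m` that starts in the all-zero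
state, applies its gates in order, measures all qubits in the computational basis, and returns
`numOut` strings of `n` bits, read from distinct wires. -/
structure OracleCircuit (n m : ℕ) where
  wires : ℕ
  gates : List (QGate wires n m)
  numOut : ℕ
  out : Fin numOut × Fin n ↪ Fin wires

namespace OracleCircuit

/-- The size: qubits, gates (an oracle query counts as one gate) and output strings. -/
def size {n m : ℕ} (C : OracleCircuit n m) : ℕ := C.wires + C.gates.length + C.numOut

/-- The state just before the measurement, when the oracle is `F`. -/
noncomputable def finalState {n m : ℕ} (C : OracleCircuit n m)
    (F : (Fin n → Bool) → (Fin m → Bool)) : QState C.wires :=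
  C.gates.foldl (fun ψ g => g.apply F ψ) (Pi.single (fun _ => false) 1)

open Classical in
/-- The probability that the list of returned strings satisfies `P`, when the oracle is `F`. -/
noncomputable def prob {n m : ℕ} (C : OracleCircuit n m) (F : (Fin n → Bool) → (Fin m → Bool))
    (P : (Fin C.numOut → Fin n → Bool) → Prop) : ℝ :=
  ∑ s : Fin C.wires → Bool,
    if P (fun j b => s (C.out (j, b))) then ‖C.finalState F s‖ ^ 2 else 0

end OracleCircuit

/-! ### Encoded groups and the hidden subgroup problem -/

/-- An encoding of the elements of `G` by distinct bit strings of length `len`. -/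
structure BinEncoding (G : Type*) where
  len : ℕ
  code : G → (Fin len → Bool)
  code_injective : Function.Injective code

/-- `f i` is bounded by a polynomial in `log |G i|`. -/
def PolylogBounded {ι : Type*} (G : ι → Type*) (f : ι → ℕ) : Prop :=
  ∃ p : Polynomial ℕ, ∀ i, f i ≤ p.eval (Nat.log 2 (Nat.card (G i)))

/-- The groups `G i` are encoded by strings of polynomial length in `log |G i|`, in such a way that
multiplication is carried out by Boolean circuits of polynomial size in `log |G i|`. -/
def EfficientlyEncoded {ι : Type*} (G : ι → Type*) [∀ i, Group (G i)]
    (e : ∀ i, BinEncoding (G i)) : Prop :=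
  PolylogBounded G (fun i => (e i).len) ∧
  ∃ C : ∀ i, BoolCircuit ((e i).len + (e i).len) (e i).len,
    PolylogBounded G (fun i => (C i).size) ∧
    ∀ i (x y : G i),
      (C i).eval (Fin.append ((e i).code x) ((e i).code y)) = (e i).code (x * y)

/-- The function `F`, restricted to the (codes of) elements of `G`, is constant on each left coset
of `L` and distinct on distinct left cosets. The values of `F` on strings that encode no element
are unrestricted. -/
def Hides {G : Type*} [Group G] (e : BinEncoding G) {m : ℕ}
    (F : (Fin e.len → Bool) → (Fin m → Bool)) (L : Subgroup G) : Prop :=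
  ∀ x y : G, F (e.code x) = F (e.code y) ↔ x⁻¹ * y ∈ L

/-- The strings `w` are codes of elements that generate `L`. -/
def GeneratorsOf {G : Type*} [Group G] (e : BinEncoding G) (L : Subgroup G) {r : ℕ}
    (w : Fin r → Fin e.len → Bool) : Prop :=
  ∃ g : Fin r → G, (∀ j, e.code (g j) = w j) ∧ Subgroup.closure (Set.range g) = L

/-- The circuit `C` solves the hidden subgroup problem over the encoded group `G`, with labels
of `m` bits: whatever subgroup is hidden by the oracle, `C` returns generators of it with
probability at least `2/3`. -/
def SolvesHSP {G : Type*} [Group G] (e : BinEncoding G) {m : ℕ}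
    (C : OracleCircuit e.len m) : Prop :=
  ∀ (L : Subgroup G) (F : (Fin e.len → Bool) → (Fin m → Bool)), Hides e F L →
    2 / 3 ≤ C.prob F (GeneratorsOf e L)

/-- The hidden subgroup problem over the groups `G i`, in the encodings `e i`, is solved by quantum
circuits of polynomial size in `log |G i|`, for oracles whose labels have any polynomial length
in `log |G i|`. -/
def FullyReconstructibleIn {ι : Type*} (G : ι → Type*) [∀ i, Group (G i)]
    (e : ∀ i, BinEncoding (G i)) : Prop :=
  ∀ m : ι → ℕ, PolylogBounded G m →
    ∃ C : ∀ i, OracleCircuit (e i).len (m i),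
      PolylogBounded G (fun i => (C i).size) ∧ ∀ i, SolvesHSP (e i) (C i)

/-- Hidden subgroups of the family `G` are fully reconstructible: the hidden subgroup problem is
solved by polynomial-size quantum circuits whenever the groups are encoded in such a way that
multiplication is efficient. -/
def FullyReconstructible {ι : Type*} (G : ι → Type*) [∀ i, Group (G i)] : Prop :=
  ∀ e : ∀ i, BinEncoding (G i), EfficientlyEncoded G e → FullyReconstructibleIn G e

/-- Some transversal `t i : H i → G i` of the left cosets of `K i`, where `H i` is identified with
`G i ⧸ K i` by `φ i`, is computed in the encodings `eH` and `eG` by Boolean circuits of polynomial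
size in `log |G i|`. -/
def EfficientTransversal {ι : Type*} {G H : ι → Type*} [∀ i, Group (G i)] [∀ i, Group (H i)]
    (K : ∀ i, Subgroup (G i)) [∀ i, (K i).Normal] (φ : ∀ i, G i ⧸ K i ≃* H i)
    (eH : ∀ i, BinEncoding (H i)) (eG : ∀ i, BinEncoding (G i)) : Prop :=
  ∃ t : ∀ i, H i → G i, (∀ i h, φ i (QuotientGroup.mk (t i h)) = h) ∧
  ∃ C : ∀ i, BoolCircuit (eH i).len (eG i).len,
    PolylogBounded G (fun i => (C i).size) ∧
    ∀ i h, (C i).eval ((eH i).code h) = (eG i).code (t i h)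

/-! Let π : G → H be the projection with kernel K, let t be a transversal, and let F hide L ≤ G.
Define a label on H by F'(h) = the least of the |K| labels F(t(h)k), k ∈ K. If h⁻¹h' = π(l) with l ∈
L, right multiplication by l carries the coset over h onto the coset over h' without changing
labels, so both carry the same set of labels; conversely, a common label forces h⁻¹h' ∈ π(L). Hence
F' hides π(L) (`hides_map`), and the circuit for H returns generators h_j of π(L). Each h_j has a
lift t(h_j)k in L. Since K is small, all products t(h_j)k and all k ∈ K can be tried, keeping those
with the label of 1, that is, those in L. The kept elements contain L ∩ K and lifts of the
generators of π(L), so they generate L (`closure_eq_of_lifts`, `exists_solvesHSP`).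

When no encoding of H is given, h is encoded by the least code in its coset. Multiplication in H is
then multiplication in G followed by a minimum over K, and the transversal is computed by a circuit
without gates (`exists_quotient_encoding`).

The remaining work is to turn F' into a quantum query. A classical program with queries to F is run
by reversible gates, its output is XORed into the target, and the run is undone
(`Computes.exists_gates`). The scratch bits are cleared, so interference is the same as with a
genuine oracle F'. Only the amplitudes of basis states with clean scratch need to be followed: the
success probability is a sum of nonnegative terms, so these already bound it below
(`exists_oracleCircuit`).

Polynomial bounds in log |G| and in log |H| are interchangeable because |K| is polynomial in log
|H|. -/

/-! ### Straight-line programs with oracle queries -/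

/-- An instruction of a straight-line program over an append-only memory of bits: append the NAND
of two bits, or append the `n` bits of a query followed by the answer of the oracle. A position
that is not yet written reads as `0`. -/
inductive Instr (n : ℕ) : Type
  | nand (a b : ℕ)
  | query (x : Fin n → ℕ)

namespace Instr

variable {n m : ℕ}

/-- The bits that an instruction appends to the memory `w`. -/
def new (F : (Fin n → Bool) → (Fin m → Bool)) (w : List Bool) : Instr n → List Bool
  | nand a b => [!(w.getD a false && w.getD b false)]
  | query x => List.ofFn (fun k => w.getD (x k) false) ++
      List.ofFn (F fun k => w.getD (x k) false)

/-- The number of bits that an instruction appends when oracle answers have `m` bits. -/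
def bits (m : ℕ) : Instr n → ℕ
  | nand _ _ => 1
  | query _ => n + m

theorem length_new (F : (Fin n → Bool) → (Fin m → Bool)) (w : List Bool) (I : Instr n) :
    (I.new F w).length = I.bits m := by
  cases I <;> simp [new, bits]

/-- The memory after running a program. -/
def run (F : (Fin n → Bool) → (Fin m → Bool)) (P : List (Instr n)) (w : List Bool) : List Bool :=
  P.foldl (fun v I => v ++ I.new F v) w

/-- The number of bits that a program appends. -/
def totalBits (m : ℕ) (P : List (Instr n)) : ℕ := (P.map (bits m)).sum

/-- The cost of a program: its instructions and the bits that it writes. -/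
def cost (m : ℕ) (P : List (Instr n)) : ℕ := P.length + totalBits m P

@[simp] theorem run_nil (F : (Fin n → Bool) → (Fin m → Bool)) (w : List Bool) :
    run F [] w = w := rfl

@[simp] theorem run_cons (F : (Fin n → Bool) → (Fin m → Bool)) (I : Instr n) (P : List (Instr n))
    (w : List Bool) : run F (I :: P) w = run F P (w ++ I.new F w) := rfl

theorem run_append (F : (Fin n → Bool) → (Fin m → Bool)) (P Q : List (Instr n)) (w : List Bool) :
    run F (P ++ Q) w = run F Q (run F P w) := by
  simp [run]

@[simp] theorem totalBits_nil : totalBits m ([] : List (Instr n)) = 0 := rfl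

@[simp] theorem totalBits_cons (I : Instr n) (P : List (Instr n)) :
    totalBits m (I :: P) = I.bits m + totalBits m P := by
  simp [totalBits]

@[simp] theorem totalBits_append (P Q : List (Instr n)) :
    totalBits m (P ++ Q) = totalBits m P + totalBits m Q := by
  simp [totalBits]

@[simp] theorem cost_append (P Q : List (Instr n)) :
    cost m (P ++ Q) = cost m P + cost m Q := by
  simp [cost]; omega

theorem length_run (F : (Fin n → Bool) → (Fin m → Bool)) (P : List (Instr n)) (w : List Bool) :
    (run F P w).length = w.length + totalBits m P := by
  induction P generalizing w with
  | nil => simp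
  | cons I P ih => simp [ih, length_new]; omega

theorem getD_run_of_lt (F : (Fin n → Bool) → (Fin m → Bool)) (P : List (Instr n)) (w : List Bool)
    {i : ℕ} (hi : i < w.length) : (run F P w).getD i false = w.getD i false := by
  induction P generalizing w with
  | nil => simp
  | cons I P ih =>
    rw [run_cons, ih _ (by simp; omega), List.getD_append _ _ _ _ hi]

end Instr

open Instr

/-- The function `f`, which may depend on an oracle, is computed by programs of cost at most `c`,
wherever in the memory the arguments are. The appended bits `r` depend on the arguments only. -/
def Computes {n m : ℕ} {α β : Type*}
    (f : ((Fin n → Bool) → (Fin m → Bool)) → (α → Bool) → (β → Bool)) (c : ℕ) : Prop :=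
  ∀ (L : ℕ) (p : α → ℕ), (∀ a, p a < L) → ∃ (P : List (Instr n)) (q : β → ℕ)
    (r : ((Fin n → Bool) → (Fin m → Bool)) → (α → Bool) → List Bool),
    cost m P ≤ c ∧ (∀ b, q b < L + totalBits m P) ∧ (∀ b, (∃ a, q b = p a) ∨ L ≤ q b) ∧
    ∀ F w, w.length = L → run F P w = w ++ r F (fun a => w.getD (p a) false) ∧
      ∀ b, (run F P w).getD (q b) false = f F (fun a => w.getD (p a) false) b

/-! ### Composition rules and basic programs. -/

namespace Computes

variable {n m : ℕ} {α β γ : Type*}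

theorem mono {f : ((Fin n → Bool) → (Fin m → Bool)) → (α → Bool) → (β → Bool)} {c d : ℕ}
    (hf : Computes f c) (h : c ≤ d) : Computes f d := fun L p hp => by
  obtain ⟨P, q, r, hc, h'⟩ := hf L p hp
  exact ⟨P, q, r, hc.trans h, h'⟩

theorem of_eq {f g : ((Fin n → Bool) → (Fin m → Bool)) → (α → Bool) → (β → Bool)} {c d : ℕ}
    (hf : Computes f c) (h : ∀ F x, f F x = g F x) (hcd : c ≤ d) : Computes g d := by
  obtain rfl : f = g := funext fun F => funext (h F)
  exact hf.mono hcd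

/-- Moving bits needs no instruction, because outputs may be read at argument positions. -/
theorem rewire (g : β → α) :
    Computes (n := n) (m := m) (fun _ x b => x (g b)) 0 := fun L p hp =>
  ⟨[], p ∘ g, fun _ _ => [], by simp [cost], fun b => by simpa using hp (g b),
    fun b => Or.inl ⟨g b, rfl⟩, fun F w _ => ⟨by simp, fun b => rfl⟩⟩

theorem comp {f : ((Fin n → Bool) → (Fin m → Bool)) → (α → Bool) → (β → Bool)}
    {g : ((Fin n → Bool) → (Fin m → Bool)) → (β → Bool) → (γ → Bool)} {c d : ℕ}
    (hg : Computes g d) (hf : Computes f c) : Computes (fun F x => g F (f F x)) (c + d) := by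
  intro L p hp
  obtain ⟨P, q, u, hc, hq, hq', h⟩ := hf L p hp
  obtain ⟨Q, r, v, hd, hr, hr', k⟩ := hg (L + totalBits m P) q hq
  refine ⟨P ++ Q, r, fun F x => u F x ++ v F (f F x), by simp; omega,
    fun b => by have := hr b; simp; omega, fun b => ?_, fun F w hw => ?_⟩
  · rcases hr' b with ⟨a, ha⟩ | hb
    · rw [ha]; exact hq' a
    · right; omega
  · obtain ⟨h1, h2⟩ := h F w hw
    obtain ⟨k1, k2⟩ := k F (run F P w) (by rw [length_run, hw])
    have e : (fun b => (run F P w).getD (q b) false) = f F (fun a => w.getD (p a) false) :=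
      funext h2
    rw [e] at k1 k2
    rw [run_append]
    exact ⟨by rw [k1, h1, List.append_assoc], k2⟩

/-- Memory is append-only, so the second program still finds the arguments, and the outputs of the
first survive it. -/
theorem pair {f : ((Fin n → Bool) → (Fin m → Bool)) → (α → Bool) → (β → Bool)}
    {g : ((Fin n → Bool) → (Fin m → Bool)) → (α → Bool) → (γ → Bool)} {c d : ℕ}
    (hf : Computes f c) (hg : Computes g d) :
    Computes (fun F x => Sum.elim (f F x) (g F x)) (c + d) := by
  intro L p hp
  obtain ⟨P, q, u, hc, hq, hq', h⟩ := hf L p hp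
  obtain ⟨Q, r, v, hd, hr, hr', k⟩ := hg (L + totalBits m P) p
    (fun a => (hp a).trans_le (by omega))
  refine ⟨P ++ Q, Sum.elim q r, fun F x => u F x ++ v F x, by simp; omega, ?_, ?_,
    fun F w hw => ?_⟩
  · rintro (b | b)
    · have := hq b; simp; omega
    · have := hr b; simp; omega
  · rintro (b | b)
    · exact hq' b
    · rcases hr' b with ⟨a, ha⟩ | hb
      · exact Or.inl ⟨a, ha⟩
      · right; simp only [Sum.elim_inr]; omega
  · obtain ⟨h1, h2⟩ := h F w hw
    have hl : (run F P w).length = L + totalBits m P := by rw [length_run, hw]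
    obtain ⟨k1, k2⟩ := k F (run F P w) hl
    have e : (fun a => (run F P w).getD (p a) false) = fun a => w.getD (p a) false :=
      funext fun a => getD_run_of_lt _ _ _ (by rw [hw]; exact hp a)
    rw [e] at k1 k2
    rw [run_append]
    refine ⟨by rw [k1, h1, List.append_assoc], ?_⟩
    rintro (b | b)
    · rw [Sum.elim_inl, getD_run_of_lt _ _ _ (by rw [hl]; exact hq b), h2]
      rfl
    · exact k2 b

theorem const (v : β → Bool) : Computes (n := n) (m := m) (fun _ (_ : α → Bool) => v) 4 := by
  intro L p _
  -- Position `L` is still unwritten for the first NAND, which therefore writes 1 there; the second,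
  -- identical NAND reads this 1 and writes 0.
  refine ⟨[.nand L L, .nand L L], fun b => if v b then L else L + 1, fun _ _ => [true, false],
    by simp [cost, bits], fun b => ?_, fun b => ?_, ?_⟩
  · simp [bits]; split <;> omega
  · right; dsimp only; split <;> omega
  · rintro F w rfl
    refine ⟨by simp [new, List.getD_eq_getElem?_getD], fun b => ?_⟩
    cases hv : v b <;> simp [new, List.getD_eq_getElem?_getD, hv]

theorem family {ι : Type*} [Fintype ι]
    {f : ι → ((Fin n → Bool) → (Fin m → Bool)) → (α → Bool) → (β → Bool)} {c : ℕ}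
    (hf : ∀ i, Computes (f i) c) :
    Computes (fun F x (ib : ι × β) => f ib.1 F x ib.2) (Fintype.card ι * c) := by
  classical
  suffices H : ∀ s : Finset ι,
      Computes (fun F x (ib : s × β) => f ib.1 F x ib.2) (s.card * c) by
    have := (rewire (n := n) (m := m)
      (fun ib : ι × β => ((⟨ib.1, Finset.mem_univ _⟩, ib.2) : ↥(Finset.univ : Finset ι) × β))).comp
      (H Finset.univ)
    exact this
  intro s
  induction s using Finset.induction_on with
  | empty =>
    intro L p _
    exact ⟨[], fun _ => 0, fun _ _ => [], by simp [cost],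
      fun ib => (Finset.notMem_empty _ ib.1.2).elim, fun ib => (Finset.notMem_empty _ ib.1.2).elim,
      fun _ _ _ => ⟨by simp, fun ib => (Finset.notMem_empty _ ib.1.2).elim⟩⟩
  | insert i s his ih =>
    have := (rewire (n := n) (m := m) (fun ib : ↥(insert i s : Finset ι) × β =>
      if h : ib.1.1 ∈ s then (Sum.inr (⟨ib.1.1, h⟩, ib.2) : β ⊕ (s × β))
      else Sum.inl ib.2)).comp ((hf i).pair ih)
    refine this.of_eq (fun F x => ?_) (by rw [Finset.card_insert_of_notMem his, add_mul]; omega)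
    funext ⟨⟨j, hj⟩, b⟩
    by_cases h : j ∈ s
    · simp [h]
    · obtain rfl : j = i := by simpa [h] using hj
      simp [h]

theorem nand {f g : ((Fin n → Bool) → (Fin m → Bool)) → (α → Bool) → (Unit → Bool)} {c d : ℕ}
    (hf : Computes f c) (hg : Computes g d) :
    Computes (fun F x (_ : Unit) => !(f F x () && g F x ())) (c + d + 2) := by
  have : Computes (n := n) (m := m)
      (fun _ (x : Unit ⊕ Unit → Bool) (_ : Unit) => !(x (.inl ()) && x (.inr ()))) 2 := by
    intro L p _
    refine ⟨[.nand (p (.inl ())) (p (.inr ()))], fun _ => L,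
      fun _ x => [!(x (.inl ()) && x (.inr ()))], by simp [cost, bits],
      fun _ => by simp [bits], fun _ => Or.inr le_rfl, ?_⟩
    rintro F w rfl
    exact ⟨rfl, fun b => by simp [new, List.getD_eq_getElem?_getD]⟩
  exact this.comp (hf.pair hg)

theorem query : Computes (n := n) (m := m) (fun F x => F x) (n + m + 1) := by
  intro L p _
  -- The answer starts at `L + n`, after the copy of the query string.
  refine ⟨[.query p], fun j => L + n + j, fun F x => List.ofFn x ++ List.ofFn (F x),
    by simp [cost, bits]; omega,
    fun j => by simp [bits]; omega, fun j => Or.inr (by dsimp only; omega), ?_⟩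
  rintro F w rfl
  exact ⟨rfl, fun b => by simp [new, List.getD_eq_getElem?_getD, add_assoc]⟩

/-- The gates are translated one by one, with input wires sent to the argument positions and gate
wires to fresh positions. -/
theorem circuit {k l : ℕ} (C : BoolCircuit k l) :
    Computes (n := n) (m := m) (fun _ x => C.eval x) (2 * C.size + 4) := by
  intro L p hp
  set ρ : ℕ → ℕ := fun a => if h : a < k then p ⟨a, h⟩ else L + (a - k) with hρ
  set tr : ℕ × ℕ → Instr n := fun g => .nand (ρ g.1) (ρ g.2)
  have read : ∀ w t : List Bool, w.length = L → ∀ a, (w ++ t).getD (ρ a) false =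
      (List.ofFn (fun i => w.getD (p i) false) ++ t).getD a false := by
    rintro w t rfl a
    by_cases h : a < k
    · have hρa : ρ a = p ⟨a, h⟩ := by simp [hρ, h]
      rw [hρa, List.getD_append _ _ _ _ (hp _), List.getD_append _ _ _ _ (by simpa using h)]
      simp [List.getD_eq_getElem?_getD, h]
    · have hρa : ρ a = w.length + (a - k) := by simp [hρ, h]
      rw [hρa, List.getD_append_right _ _ _ _ (by omega),
        List.getD_append_right _ _ _ _ (by rw [List.length_ofFn]; omega)]
      simp
  have key : ∀ (F : (Fin n → Bool) → (Fin m → Bool)) (w : List Bool), w.length = L →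
      ∀ (gs : List (ℕ × ℕ)) (t : List Bool), ∃ t',
      run F (gs.map tr) (w ++ t) = w ++ t' ∧
      BoolCircuit.wires gs (List.ofFn (fun i => w.getD (p i) false) ++ t) =
        List.ofFn (fun i => w.getD (p i) false) ++ t' := by
    intro F w hw gs
    induction gs with
    | nil => exact fun t => ⟨t, rfl, rfl⟩
    | cons g gs ih =>
      intro t
      obtain ⟨t', h1, h2⟩ := ih (t ++ (tr g).new F (w ++ t))
      refine ⟨t', by rw [List.map_cons, run_cons, List.append_assoc, h1], ?_⟩
      rw [← h2, ← List.append_assoc]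
      simp only [tr, new, read w t hw]
      rfl
  have hbits : totalBits m (C.gates.map tr) = C.size := by
    have : ∀ gs : List (ℕ × ℕ), totalBits m (gs.map tr) = gs.length := by
      intro gs
      induction gs with
      | nil => rfl
      | cons g gs ih => simp [ih, tr, bits]; omega
    exact this _
  -- An output wire that the circuit never writes reads 0, but its translated position could be
  -- written by a later program. The two extra NANDs produce a permanent 0 at `L + C.size + 1` for
  -- such outputs.
  refine ⟨C.gates.map tr ++ [.nand (L + C.size) (L + C.size), .nand (L + C.size) (L + C.size)],
    fun j => if ρ (C.out j) < L + C.size then ρ (C.out j) else L + C.size + 1,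
    fun F x => (BoolCircuit.wires C.gates (List.ofFn x)).drop k ++ [true, false],
    ?_, fun j => ?_, fun j => ?_, ?_⟩
  · rw [cost_append, cost, hbits]
    simp [cost, bits, BoolCircuit.size]; omega
  · simp only [totalBits_append, hbits, totalBits_cons, bits, totalBits_nil]; split_ifs <;> omega
  · dsimp only
    split_ifs
    · by_cases h : C.out j < k
      · left; exact ⟨⟨_, h⟩, by simp [hρ, h]⟩
      · right; simp [hρ, h]
    · right; omega
  · rintro F w rfl
    have hlen : (run F (C.gates.map tr) w).length = w.length + C.size := by
      rw [length_run, hbits]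
    obtain ⟨t, h1, h2⟩ := key F w rfl C.gates []
    rw [List.append_nil] at h1 h2
    have htail : run F (C.gates.map tr ++
        [.nand (w.length + C.size) (w.length + C.size),
          .nand (w.length + C.size) (w.length + C.size)]) w = w ++ (t ++ [true, false]) := by
      have ht : w.length + C.size = (w ++ t).length := by rw [← h1, hlen]
      rw [run_append, h1, ht]
      simp [new, List.getD_eq_getElem?_getD]
    refine ⟨?_, fun j => ?_⟩
    · rw [htail]
      dsimp only
      rw [h2, List.drop_left' (by simp)]
    · change _ = (BoolCircuit.wires C.gates _).getD (C.out j) false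
      rw [h2, ← read w t rfl, ← h1]
      dsimp only
      split_ifs with h
      · rw [run_append, getD_run_of_lt _ _ _ (by rw [hlen]; exact h)]
      · rw [List.getD_eq_default (run F (C.gates.map _) w) _ (by rw [hlen]; omega), htail,
          ← List.append_assoc]
        rw [h1] at hlen
        rw [List.getD_append_right _ _ _ _ (by omega), ← hlen]
        simp

/-- A function computed by programs with a trivial oracle is computed by a Boolean circuit. -/
theorem exists_boolCircuit {k l : ℕ}
    {f : ((Fin 0 → Bool) → (Fin 0 → Bool)) → (Fin k → Bool) → (Fin l → Bool)} {c : ℕ}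
    (hf : Computes f c) : ∃ C : BoolCircuit k l, C.size ≤ c ∧ ∀ F x, C.eval x = f F x := by
  obtain ⟨P, q, _, hc, _, _, h⟩ := hf k (fun i => i) (fun i => i.2)
  -- With queries and answers of length 0, a query appends nothing and can be dropped.
  set tr : Instr 0 → Option (ℕ × ℕ) := fun I => match I with
    | .nand a b => some (a, b)
    | .query _ => none with htr
  have key : ∀ (F : (Fin 0 → Bool) → (Fin 0 → Bool)) (P : List (Instr 0)) (w : List Bool),
      BoolCircuit.wires (P.filterMap tr) w = run F P w := by
    intro F P
    induction P with
    | nil => intro w; rfl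
    | cons I P ih =>
      intro w
      cases I with
      | nand a b => rw [run_cons, ← ih]; rfl
      | query x => rw [run_cons, ← ih]; simp [htr, new]
  refine ⟨⟨P.filterMap tr, q⟩, ?_, fun F x => ?_⟩
  · exact (List.length_filterMap_le _ _).trans (by simp only [cost] at hc; omega)
  · funext j
    have := (h F (List.ofFn x) (by simp)).2 j
    simp only [BoolCircuit.eval, key F]
    rw [this]
    congr 1
    funext i
    simp [List.getD_eq_getElem?_getD]

end Computes

/-! ### Comparison of bit strings -/

section BitStrings

variable {β κ : Type*}

/-- Lexicographic comparison of two bit strings along a list of positions. -/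
def strLT (l : List β) (u v : β → Bool) : Bool :=
  l.foldr (fun j r => if u j = v j then r else v j) false

/-- The number with the binary digits of `u` along a list of positions. -/
def strVal (l : List β) (u : β → Bool) : ℕ :=
  match l with
  | [] => 0
  | j :: l => (u j).toNat * 2 ^ l.length + strVal l u

theorem strVal_lt (l : List β) (u : β → Bool) : strVal l u < 2 ^ l.length := by
  induction l with
  | nil => simp [strVal]
  | cons j l ih => cases h : u j <;> simp [strVal, h, pow_succ] <;> omega

theorem strLT_eq_true_iff (l : List β) (u v : β → Bool) :
    strLT l u v = true ↔ strVal l u < strVal l v := by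
  induction l with
  | nil => simp [strLT, strVal]
  | cons j l ih =>
    have h1 := strVal_lt l u
    have h2 := strVal_lt l v
    have : strLT (j :: l) u v = if u j = v j then strLT l u v else v j := rfl
    rw [this]
    cases hu : u j <;> cases hv : v j <;> simp [strVal, hu, hv, ih] <;> omega

theorem strVal_injOn (l : List β) {u v : β → Bool} (h : strVal l u = strVal l v) :
    ∀ j ∈ l, u j = v j := by
  induction l with
  | nil => simp
  | cons j l ih =>
    have h1 := strVal_lt l u
    have h2 := strVal_lt l v
    have : u j = v j ∧ strVal l u = strVal l v := by
      cases hu : u j <;> cases hv : v j <;> simp [strVal, hu, hv] at h ⊢ <;> omega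
    intro i hi
    rcases List.mem_cons.1 hi with rfl | hi
    · exact this.1
    · exact ih this.2 i hi

variable [Fintype β]

theorem strVal_univ_injective :
    Function.Injective (strVal (Finset.univ : Finset β).toList) := fun _ _ h =>
  funext fun j => strVal_injOn _ h j (by simp)

/-- The lexicographic minimum of two bit strings. -/
noncomputable def strMin (u v : β → Bool) : β → Bool :=
  if strLT Finset.univ.toList u v then u else v

theorem strVal_strMin (u v : β → Bool) :
    strVal Finset.univ.toList (strMin u v) =
      min (strVal Finset.univ.toList u) (strVal Finset.univ.toList v) := by
  unfold strMin
  split_ifs with h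
  · rw [min_eq_left ((strLT_eq_true_iff _ _ _).1 h).le]
  · rw [strLT_eq_true_iff, not_lt] at h
    rw [min_eq_right h]

theorem strMin_eq_or (u v : β → Bool) : strMin u v = u ∨ strMin u v = v := by
  unfold strMin
  split_ifs <;> simp

/-- Equality of bit strings, decided by two comparisons. -/
noncomputable def strEq (u v : β → Bool) : Bool :=
  !(strLT Finset.univ.toList u v) && !(strLT Finset.univ.toList v u)

theorem strEq_eq_true_iff (u v : β → Bool) : strEq u v = true ↔ u = v := by
  have h : strEq u v = true ↔ ¬strLT Finset.univ.toList u v = true ∧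
      ¬strLT Finset.univ.toList v u = true := by simp [strEq]
  rw [h, strLT_eq_true_iff, strLT_eq_true_iff, not_lt, not_lt, and_comm, ← le_antisymm_iff,
    strVal_univ_injective.eq_iff]

/-- The minimum of the strings `a k₀` and `a k`, for `k` in a list. -/
noncomputable def listMin (a : κ → β → Bool) (k₀ : κ) (l : List κ) : β → Bool :=
  l.foldr (fun k r => strMin (a k) r) (a k₀)

theorem listMin_mem (a : κ → β → Bool) (k₀ : κ) (l : List κ) : ∃ k, listMin a k₀ l = a k := by
  induction l with
  | nil => exact ⟨k₀, rfl⟩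
  | cons k l ih =>
    change ∃ k', strMin (a k) (listMin a k₀ l) = a k'
    rcases strMin_eq_or (a k) (listMin a k₀ l) with h | h
    · exact ⟨k, h⟩
    · rwa [h]

theorem strVal_listMin_le (a : κ → β → Bool) (k₀ : κ) (l : List κ) :
    ∀ k ∈ l, strVal Finset.univ.toList (listMin a k₀ l) ≤ strVal Finset.univ.toList (a k) := by
  induction l with
  | nil => simp
  | cons k l ih =>
    intro k' hk'
    change strVal _ (strMin (a k) (listMin a k₀ l)) ≤ _
    rw [strVal_strMin]
    rcases List.mem_cons.1 hk' with rfl | hk'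
    · exact min_le_left _ _
    · exact (min_le_right _ _).trans (ih k' hk')

/-- The minimum of a finite family of strings. -/
noncomputable def familyMin [Fintype κ] (k₀ : κ) (a : κ → β → Bool) : β → Bool :=
  listMin a k₀ Finset.univ.toList

theorem familyMin_mem [Fintype κ] (k₀ : κ) (a : κ → β → Bool) : ∃ k, familyMin k₀ a = a k :=
  listMin_mem _ _ _

/-- The minimum of a family depends only on the set of its members. -/
theorem familyMin_congr [Fintype κ] (k₀ : κ) {a b : κ → β → Bool} (hab : ∀ k, ∃ k', a k = b k')
    (hba : ∀ k, ∃ k', b k = a k') : familyMin k₀ a = familyMin k₀ b := by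
  refine strVal_univ_injective (le_antisymm ?_ ?_)
  · obtain ⟨k, hk⟩ := familyMin_mem k₀ b
    obtain ⟨k', hk'⟩ := hba k
    rw [hk, hk']
    exact strVal_listMin_le _ _ _ _ (by simp)
  · obtain ⟨k, hk⟩ := familyMin_mem k₀ a
    obtain ⟨k', hk'⟩ := hab k
    rw [hk, hk']
    exact strVal_listMin_le _ _ _ _ (by simp)

end BitStrings

/-! ### Programs for selection, comparison and minima of strings. -/

namespace Computes

variable {n m : ℕ} {α β γ : Type*}

theorem mux [Fintype β] {s : ((Fin n → Bool) → (Fin m → Bool)) → (α → Bool) → (Unit → Bool)}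
    {f g : ((Fin n → Bool) → (Fin m → Bool)) → (α → Bool) → (β → Bool)} {b c d : ℕ}
    (hs : Computes s b) (hf : Computes f c) (hg : Computes g d) :
    Computes (fun F x => if s F x () then f F x else g F x)
      (b + (c + d) + Fintype.card β * 8) := by
  have bit : ∀ i : Unit ⊕ (β ⊕ β), Computes (n := n) (m := m)
      (fun _ (x : Unit ⊕ (β ⊕ β) → Bool) (_ : Unit) => x i) 0 := fun i => rewire fun _ => i
  -- Selection is (s ∧ f) ∨ (¬s ∧ g): four NANDs for each bit, each costing one instruction and one
  -- written bit.
  have h := family fun j : β => ((bit (.inl ())).nand (bit (.inr (.inl j)))).nand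
    (((bit (.inl ())).nand (bit (.inl ()))).nand (bit (.inr (.inr j))))
  have := ((rewire (n := n) (m := m) fun j : β => (j, ())).comp h).comp (hs.pair (hf.pair hg))
  refine this.of_eq (fun F x => ?_) (by omega)
  funext j
  cases hs : s F x () <;> simp [hs]

theorem strLT (l : List β) :
    Computes (n := n) (m := m)
      (fun _ (x : β ⊕ β → Bool) (_ : Unit) => _root_.strLT l (x ∘ .inl) (x ∘ .inr))
      (12 * l.length + 4) := by
  induction l with
  | nil => exact const fun _ => false
  | cons j l ih =>
    have bit : ∀ i : β ⊕ β, Computes (n := n) (m := m)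
      (fun _ (x : β ⊕ β → Bool) (_ : Unit) => x i) 0 := fun i => rewire fun _ => i
    have hu := bit (.inl j)
    have hv := bit (.inr j)
    -- This is (¬u ∧ v) ∨ (¬(u ∧ ¬v) ∧ r), where r is the comparison of the remaining positions.
    have := ((hu.nand hu).nand hv).nand ((hu.nand (hv.nand hv)).nand ih)
    refine this.of_eq (fun F x => ?_) (by rw [List.length_cons]; omega)
    funext i
    have h : _root_.strLT (j :: l) (x ∘ Sum.inl) (x ∘ Sum.inr) =
      if x (.inl j) = x (.inr j) then _root_.strLT l (x ∘ .inl) (x ∘ .inr) else x (.inr j) := rfl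
    rw [h]
    cases x (.inl j) <;> cases x (.inr j) <;> simp

theorem strMin [Fintype β]
    {f g : ((Fin n → Bool) → (Fin m → Bool)) → (α → Bool) → (β → Bool)} {c d : ℕ}
    (hf : Computes f c) (hg : Computes g d) :
    Computes (fun F x => _root_.strMin (f F x) (g F x)) (c + d + (20 * Fintype.card β + 4)) := by
  have h := (strLT (n := n) (m := m) (Finset.univ : Finset β).toList).mux
    (rewire (Sum.inl : β → β ⊕ β)) (rewire (Sum.inr : β → β ⊕ β))
  have := h.comp (hf.pair hg)
  refine this.mono ?_
  simp
  omega

theorem strEq [Fintype β]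
    {f g : ((Fin n → Bool) → (Fin m → Bool)) → (α → Bool) → (β → Bool)} {c d : ℕ}
    (hf : Computes f c) (hg : Computes g d) :
    Computes (fun F x (_ : Unit) => _root_.strEq (f F x) (g F x))
      (c + d + (96 * Fintype.card β + 46)) := by
  have h := strLT (n := n) (m := m) (Finset.univ : Finset β).toList
  have h' := h.comp (rewire (Sum.swap : β ⊕ β → β ⊕ β))
  -- Repeated subexpressions are recomputed rather than shared, so the final formula contains eight
  -- comparisons; hence 96 = 8 · 12.
  have h1 := (h.nand h).nand (h'.nand h')
  refine ((h1.nand h1).comp (hf.pair hg)).of_eq (fun F x => ?_) (by simp; omega)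
  funext i
  simp only [_root_.strEq, Bool.and_self]
  change (!!(!(_root_.strLT _ (f F x) (g F x)) && !(_root_.strLT _ (g F x) (f F x)))) = _
  simp

theorem familyMin {κ : Type*} [Fintype κ] [Fintype β] (k₀ : κ)
    {f : κ → ((Fin n → Bool) → (Fin m → Bool)) → (α → Bool) → (β → Bool)} {c : ℕ}
    (hf : ∀ k, Computes (f k) c) :
    Computes (fun F x => _root_.familyMin k₀ fun k => f k F x)
      (Fintype.card κ * (c + (20 * Fintype.card β + 4)) + c) := by
  suffices H : ∀ l : List κ, Computes (fun F x => listMin (fun k => f k F x) k₀ l)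
      (l.length * (c + (20 * Fintype.card β + 4)) + c) by
    exact (H Finset.univ.toList).mono (by simp)
  intro l
  induction l with
  | nil => exact (hf k₀).mono (by simp)
  | cons k l ih =>
    refine ((hf k).strMin ih).mono ?_
    rw [List.length_cons, add_mul]
    omega

end Computes

/-! ### Classical reversible gates -/

namespace QGate

variable {N n m : ℕ}

/-- The gates that permute the basis states. -/
def IsClassical : QGate N n m → Prop
  | hadamard _ => False
  | phase _ => False
  | _ => True

/-- The permutation of the basis states by a classical gate. -/
def perm (F : (Fin n → Bool) → (Fin m → Bool)) :
    QGate N n m → (Fin N → Bool) → (Fin N → Bool)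
  | hadamard _, s => s
  | phase _, s => s
  | flip a, s => xorBit s a true
  | cnot a c _, s => xorBit s c (s a)
  | toffoli a b c _ _, s => xorBit s c (s a && s b)
  | oracle x y _, s => xorQuery F x y s

theorem apply_of_isClassical (F : (Fin n → Bool) → (Fin m → Bool)) {g : QGate N n m}
    (hg : g.IsClassical) (ψ : QState N) : g.apply F ψ = fun s => ψ (g.perm F s) := by
  cases g <;> first | rfl | exact hg.elim

end QGate

/-! ### Reversible execution: compute, copy, uncompute. -/

section Registers

variable {N n m : ℕ}

theorem xorBit_apply (s : Fin N → Bool) (a : Fin N) (b : Bool) (w : Fin N) :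
    xorBit s a b w = if w = a then xor (s a) b else s w := by
  simp [xorBit, Function.update_apply]

theorem xorQuery_apply_of_ne (F : (Fin n → Bool) → (Fin m → Bool)) (x : Fin n ↪ Fin N)
    (y : Fin m ↪ Fin N) (s : Fin N → Bool) {w : Fin N} (hw : ∀ j, w ≠ y j) :
    xorQuery F x y s w = s w := by
  have : ¬∃ j, y j = w ∧ F (fun k => s (x k)) j = true := fun ⟨j, hj, _⟩ => hw j hj.symm
  simp [xorQuery, this]

theorem xorQuery_apply (F : (Fin n → Bool) → (Fin m → Bool)) (x : Fin n ↪ Fin N)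
    (y : Fin m ↪ Fin N) (s : Fin N → Bool) (j : Fin m) :
    xorQuery F x y s (y j) = xor (s (y j)) (F (fun k => s (x k)) j) := by
  simp [xorQuery]

theorem xorQuery_xorQuery (F : (Fin n → Bool) → (Fin m → Bool)) (x : Fin n ↪ Fin N)
    (y : Fin m ↪ Fin N) (hxy : ∀ k j, x k ≠ y j) (s : Fin N → Bool) :
    xorQuery F x y (xorQuery F x y s) = s := by
  have h : (fun k => xorQuery F x y s (x k)) = fun k => s (x k) :=
    funext fun k => xorQuery_apply_of_ne F x y s (hxy k)
  funext w
  by_cases hw : ∃ j, w = y j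
  · obtain ⟨j, rfl⟩ := hw
    rw [xorQuery_apply, h, xorQuery_apply, Bool.xor_assoc, Bool.xor_self, Bool.xor_false]
  · push Not at hw
    rw [xorQuery_apply_of_ne F x y _ hw, xorQuery_apply_of_ne F x y _ hw]

theorem QGate.perm_perm (F : (Fin n → Bool) → (Fin m → Bool)) (g : QGate N n m)
    (s : Fin N → Bool) : g.perm F (g.perm F s) = s := by
  cases g with
  | hadamard a => rfl
  | phase a => rfl
  | flip a => funext w; simp only [perm, xorBit_apply]; split_ifs with h <;> simp [h]
  | cnot a c hac =>
    funext w; simp only [perm, xorBit_apply, if_neg hac]; split_ifs with h <;> simp [h]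
  | toffoli a b c hac hbc =>
    funext w
    simp only [perm, xorBit_apply, if_neg hac, if_neg hbc]
    split_ifs with h <;> simp [h]
  | oracle x y hxy => exact xorQuery_xorQuery F x y hxy s

/-- Forward evolution of a basis state under a list of classical gates. -/
def evolve (F : (Fin n → Bool) → (Fin m → Bool)) (gs : List (QGate N n m)) (s : Fin N → Bool) :
    Fin N → Bool :=
  gs.foldl (fun s g => g.perm F s) s

theorem evolve_append (F : (Fin n → Bool) → (Fin m → Bool)) (gs hs : List (QGate N n m))
    (s : Fin N → Bool) : evolve F (gs ++ hs) s = evolve F hs (evolve F gs s) := by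
  simp [evolve]

/-- Each gate is an involution on basis states, so the reversed list is the inverse. -/
theorem evolve_reverse_evolve (F : (Fin n → Bool) → (Fin m → Bool)) (gs : List (QGate N n m))
    (s : Fin N → Bool) : evolve F gs.reverse (evolve F gs s) = s := by
  induction gs generalizing s with
  | nil => rfl
  | cons g gs ih =>
    rw [List.reverse_cons, evolve_append]
    change g.perm F (evolve F gs.reverse (evolve F gs (g.perm F s))) = s
    rw [ih, QGate.perm_perm]

/-- A classical gate acts on amplitudes by precomposition, so the amplitude at `s` is found by
pulling `s` back through the last gate first. This is why reversed lists appear in the statements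
about amplitudes. -/
theorem foldl_apply_of_isClassical (F : (Fin n → Bool) → (Fin m → Bool))
    {gs : List (QGate N n m)} (hgs : ∀ g ∈ gs, g.IsClassical) (ψ : QState N) (s : Fin N → Bool) :
    gs.foldl (fun ψ g => g.apply F ψ) ψ s = ψ (evolve F gs.reverse s) := by
  induction gs generalizing ψ with
  | nil => rfl
  | cons g gs ih =>
    rw [List.foldl_cons, ih (fun g hg => hgs g (List.mem_cons_of_mem _ hg)),
      QGate.apply_of_isClassical F (hgs g List.mem_cons_self), List.reverse_cons, evolve_append]
    rfl

/-- A state of `N` wires with the bits `w` on the first wires and `0` elsewhere. -/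
def pad (N : ℕ) (w : List Bool) : Fin N → Bool := fun i => w.getD i false

/-- XOR the bits on the wires `q` into the wires `y`. -/
theorem exists_copy {β : Type*} [Fintype β] (q : β → Fin N) (y : β ↪ Fin N)
    (hqy : ∀ b b', q b ≠ y b') :
    ∃ gs : List (QGate N n m), gs.length = Fintype.card β ∧ (∀ g ∈ gs, g.IsClassical) ∧
      ∀ F s, (∀ b, evolve F gs s (y b) = xor (s (y b)) (s (q b))) ∧
        ∀ w, (∀ b, w ≠ y b) → evolve F gs s w = s w := by
  classical
  let f : β → QGate N n m := fun b => .cnot (q b) (y b) (hqy b b)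
  have H : ∀ l : List β, l.Nodup → ∀ F s,
      (∀ b, evolve F (l.map f) s (y b) = if b ∈ l then xor (s (y b)) (s (q b)) else s (y b)) ∧
        ∀ w, (∀ b, w ≠ y b) → evolve F (l.map f) s w = s w := by
    intro l
    induction l with
    | nil => intro _ F s; exact ⟨fun b => by simp [evolve], fun w _ => rfl⟩
    | cons a l ih =>
      intro hl F s
      obtain ⟨hal, hl⟩ := List.nodup_cons.1 hl
      have e : evolve F ((a :: l).map f) s = evolve F (l.map f) (xorBit s (y a) (s (q a))) := rfl
      obtain ⟨h1, h2⟩ := ih hl F (xorBit s (y a) (s (q a)))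
      rw [e]
      refine ⟨fun b => ?_, fun w hw => ?_⟩
      · rw [h1]
        simp only [xorBit_apply, y.injective.eq_iff, if_neg (hqy _ _), List.mem_cons]
        by_cases hb : b = a
        · subst hb; simp [hal]
        · simp [hb]
      · rw [h2 w hw, xorBit_apply, if_neg (hw a)]
  refine ⟨Finset.univ.toList.map f, by simp, ?_, fun F s => ?_⟩
  · intro g hg
    obtain ⟨b, -, rfl⟩ := List.mem_map.1 hg
    trivial
  · obtain ⟨h1, h2⟩ := H _ (Finset.nodup_toList Finset.univ) F s
    exact ⟨fun b => by simpa using h1 b, h2⟩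

/-- The wire that carries position `i` of a memory of length `L`, or the last wire, which stays
zero, if this position is not yet written. -/
def wireOf (N L i : ℕ) (h : L < N) : Fin N :=
  if hi : i < L then ⟨i, hi.trans h⟩ else ⟨N - 1, by omega⟩

theorem pad_wireOf {L i : ℕ} (h : L < N) {w : List Bool} (hw : w.length = L) :
    pad N w (wireOf N L i h) = w.getD i false := by
  unfold wireOf
  split_ifs with hi
  · rfl
  · rw [List.getD_eq_default _ _ (by omega)]
    exact List.getD_eq_default _ _ (by simp; omega)

theorem wireOf_ne {L i k : ℕ} (h : L < N) (hk : L + k + 1 < N) :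
    wireOf N L i h ≠ ⟨L + k, by omega⟩ := by
  unfold wireOf
  split_ifs with hi <;> simp [Fin.ext_iff] <;> omega

open Instr

theorem exists_gates_instr (I : Instr n) {L : ℕ} (h : L + I.bits m < N) :
    ∃ gs : List (QGate N n m), gs.length ≤ 1 + I.bits m ∧ (∀ g ∈ gs, g.IsClassical) ∧
      ∀ F w, w.length = L → evolve F gs (pad N w) = pad N (w ++ I.new F w) := by
  cases I with
  | nand a b =>
    simp only [bits] at h
    have ha := wireOf_ne (N := N) (i := a) (L := L) (k := 0) (by omega) (by omega)
    have hb := wireOf_ne (N := N) (i := b) (L := L) (k := 0) (by omega) (by omega)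
    -- The target wire `L` is still 0, so the Toffoli gate writes the conjunction there and the flip
    -- negates it.
    refine ⟨[.toffoli _ _ _ ha hb, .flip ⟨L, by omega⟩], by simp [bits], ?_, ?_⟩
    · intro g hg
      simp only [List.mem_cons, List.not_mem_nil, or_false] at hg
      rcases hg with rfl | rfl <;> trivial
    · rintro F w rfl
      funext i
      simp only [evolve, List.foldl_cons, List.foldl_nil, QGate.perm, xorBit_apply, add_zero,
        pad_wireOf _ rfl, new, if_true]
      rcases lt_trichotomy (i : ℕ) w.length with hi | hi | hi
      · rw [if_neg (by rw [Fin.ext_iff]; exact hi.ne), if_neg (by rw [Fin.ext_iff]; exact hi.ne)]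
        exact (List.getD_append _ _ _ _ hi).symm
      · rw [if_pos (Fin.ext hi)]
        simp [pad, List.getD_eq_getElem?_getD, hi]
      · rw [if_neg (by rw [Fin.ext_iff]; exact hi.ne'), if_neg (by rw [Fin.ext_iff]; exact hi.ne')]
        unfold pad
        rw [List.getD_eq_default _ _ hi.le, List.getD_eq_default _ _ (by simp; omega)]
  | query x =>
    simp only [bits] at h
    let y : Fin n ↪ Fin N := ⟨fun k => ⟨L + k, by omega⟩, fun k k' hk => by
      simpa [Fin.ext_iff] using hk⟩
    let z : Fin m ↪ Fin N := ⟨fun j => ⟨L + n + j, by omega⟩, fun k k' hk => by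
      simpa [Fin.ext_iff] using hk⟩
    have hyv : ∀ k, (y k : ℕ) = L + k := fun _ => rfl
    have hzv : ∀ j, (z j : ℕ) = L + n + j := fun _ => rfl
    have hyz : ∀ k j, y k ≠ z j := fun k j hk => by
      have := congrArg Fin.val hk
      rw [hyv, hzv] at this
      omega
    -- An oracle gate needs distinct input wires, whereas the positions of a query may repeat or be
    -- unwritten. The query string is therefore first copied to fresh wires.
    obtain ⟨gs, hlen, hcl, hgs⟩ := exists_copy (n := n) (m := m)
      (fun k : Fin n => wireOf N L (x k) (by omega)) y
      (fun k k' => wireOf_ne (by omega) (by omega))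
    refine ⟨gs ++ [.oracle y z hyz], by simp [hlen, bits]; omega, ?_, ?_⟩
    · intro g hg
      rcases List.mem_append.1 hg with hg | hg
      · exact hcl g hg
      · rw [List.mem_singleton.1 hg]; trivial
    · rintro F w rfl
      set X : Fin n → Bool := fun k => w.getD (x k) false with hX
      obtain ⟨h1, h2⟩ := hgs F (pad N w)
      set s := evolve F gs (pad N w)
      have hpad : ∀ i : Fin N, w.length ≤ i → pad N w i = false := fun i hi =>
        List.getD_eq_default _ _ hi
      have hy : (fun k => s (y k)) = X := funext fun k => by
        rw [h1, pad_wireOf _ rfl, hpad _ (by rw [hyv]; omega), Bool.false_xor]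
      rw [evolve_append]
      change xorQuery F y z s = _
      funext i
      change _ = (w ++ (List.ofFn X ++ List.ofFn (F X))).getD i false
      by_cases hi : (i : ℕ) < w.length
      · rw [List.getD_append _ _ _ _ hi, xorQuery_apply_of_ne, h2]
        · rfl
        · intro k hk; rw [hk, hyv] at hi; omega
        · intro k hk; rw [hk, hzv] at hi; omega
      by_cases hi' : (i : ℕ) < w.length + n
      · obtain ⟨k, rfl⟩ : ∃ k, i = y k := ⟨⟨i - w.length, by omega⟩, Fin.ext (by rw [hyv]; dsimp only; omega)⟩
        rw [xorQuery_apply_of_ne _ _ _ _ (hyz k)]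
        have : s (y k) = X k := congrFun hy k
        rw [this, hyv]
        simp [List.getD_eq_getElem?_getD, List.getElem?_append]
      by_cases hi'' : (i : ℕ) < w.length + n + m
      · obtain ⟨j, rfl⟩ : ∃ j, i = z j :=
          ⟨⟨i - (w.length + n), by omega⟩, Fin.ext (by rw [hzv]; dsimp only; omega)⟩
        rw [xorQuery_apply, hy, h2 _ (fun k => (hyz k j).symm), hpad _ (by omega), Bool.false_xor]
        rw [hzv]
        simp [List.getD_eq_getElem?_getD, add_assoc]
      · rw [xorQuery_apply_of_ne, h2, hpad _ (by omega), List.getD_eq_default _ _ (by simp; omega)]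
        · intro k hk; rw [hk, hyv] at hi'; omega
        · intro k hk; rw [hk, hzv] at hi''; omega

theorem exists_gates_program (P : List (Instr n)) {L : ℕ} (h : L + totalBits m P < N) :
    ∃ gs : List (QGate N n m), gs.length ≤ cost m P ∧ (∀ g ∈ gs, g.IsClassical) ∧
      ∀ F w, w.length = L → evolve F gs (pad N w) = pad N (run F P w) := by
  induction P generalizing L with
  | nil => exact ⟨[], by simp, by simp, fun F w _ => rfl⟩
  | cons I P ih =>
    rw [totalBits_cons] at h
    obtain ⟨gs, h1, h2, h3⟩ := exists_gates_instr (m := m) (N := N) I (L := L) (by omega)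
    obtain ⟨hs, k1, k2, k3⟩ := ih (L := L + I.bits m) (by omega)
    refine ⟨gs ++ hs, ?_, ?_, fun F w hw => ?_⟩
    · simp only [cost, List.length_append, List.length_cons, totalBits_cons] at *
      omega
    · intro g hg
      rcases List.mem_append.1 hg with hg | hg
      · exact h2 g hg
      · exact k2 g hg
    · rw [evolve_append, h3 F w hw, k3 F _ (by simp [length_new, hw]), run_cons]

/-- Compute a function from the wires `x`, XOR its value into the wires `y`, and restore all
other wires. -/
theorem Computes.exists_gates {α β : Type*} [Fintype β]
    {f : ((Fin n → Bool) → (Fin m → Bool)) → (α → Bool) → (β → Bool)} {c M : ℕ}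
    (hf : Computes f c) (x : α → Fin M) (y : β ↪ Fin M) (hxy : ∀ a b, x a ≠ y b)
    (hN : M + c < N) :
    ∃ gs : List (QGate N n m), gs.length ≤ 2 * c + Fintype.card β ∧ (∀ g ∈ gs, g.IsClassical) ∧
      ∀ F (v v' : Fin M → Bool), (∀ w, (∀ b, w ≠ y b) → v' w = v w) →
        (∀ b, v' (y b) = xor (v (y b)) (f F (fun a => v (x a)) b)) →
        evolve F gs.reverse (pad N (List.ofFn v)) = pad N (List.ofFn v') := by
  obtain ⟨P, q, r, hc, hq, hq', h⟩ := hf M (fun a => x a) (fun a => (x a).2)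
  have hbits : totalBits m P ≤ c := by simp only [cost] at hc; omega
  obtain ⟨U, hU, hUc, hUe⟩ := exists_gates_program (m := m) (N := N) P (L := M) (by omega)
  -- No source of the copy is a target: an output of the program lies either on an argument wire,
  -- disjoint from `y`, or on a fresh wire beyond `M`.
  obtain ⟨D, hD, hDc, hDe⟩ := exists_copy (n := n) (m := m) (β := β) (N := N)
    (fun b => ⟨q b, by have := hq b; omega⟩) (y.trans (Fin.castLEEmb (by omega))) (by
      intro b b' hb
      simp only [Fin.ext_iff, Function.Embedding.trans_apply, Fin.castLEEmb_apply,
        Fin.val_castLE] at hb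
      rcases hq' b with ⟨a, ha⟩ | hb'
      · exact hxy a b' (Fin.ext (ha.symm.trans hb))
      · have := (y b').2; omega)
  refine ⟨U ++ (D.reverse ++ U.reverse), by simp; omega, ?_, ?_⟩
  · intro g hg
    simp only [List.mem_append, List.mem_reverse] at hg
    rcases hg with hg | hg | hg
    exacts [hUc g hg, hDc g hg, hUc g hg]
  · intro F v v' hv hv'
    rw [List.reverse_append, List.reverse_append, List.reverse_reverse, List.reverse_reverse,
      evolve_append, evolve_append, hUe F _ (by simp)]
    have read : ∀ (u : Fin M → Bool) (i : Fin M), (List.ofFn u).getD i false = u i := fun u i => by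
      simp [List.getD_eq_getElem?_getD]
    obtain ⟨e1, e2⟩ := h F (List.ofFn v) (by simp)
    obtain ⟨e1', -⟩ := h F (List.ofFn v') (by simp)
    have hx : (fun a => v' (x a)) = fun a => v (x a) := funext fun a => hv _ (hxy a)
    simp only [read] at e1 e2 e1'
    rw [hx] at e1'
    -- The scratch bits depend only on the wires `x`, which the copy leaves alone. So computing and
    -- then copying gives the same state as computing from `v'`, and reversing the program clears
    -- the scratch.
    have key : evolve F D (pad N (run F P (List.ofFn v))) =
        evolve F U (pad N (List.ofFn v')) := by
      rw [hUe F _ (by simp)]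
      obtain ⟨h1, h2⟩ := hDe F (pad N (run F P (List.ofFn v)))
      funext i
      by_cases hi : (i : ℕ) < M
      · have hr : ∀ u : Fin M → Bool, pad N (run F P (List.ofFn u)) i = u ⟨i, hi⟩ := fun u =>
          (getD_run_of_lt _ _ _ (by simpa using hi)).trans (read u ⟨i, hi⟩)
        by_cases hb : ∃ b, (⟨i, hi⟩ : Fin M) = y b
        · obtain ⟨b, hb⟩ := hb
          have hi' : i = (y.trans (Fin.castLEEmb (by omega))) b := Fin.ext (by have := congrArg Fin.val hb; exact this)
          have hq2 : pad N (run F P (List.ofFn v)) ⟨q b, by have := hq b; omega⟩ =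
            f F (fun a => v (x a)) b := e2 b
          rw [hr v', hb, hv' b, ← hb, ← hr v, ← hq2]
          have := h1 b
          rwa [← hi'] at this
        · push Not at hb
          rw [h2 _ (fun b hb' => hb b (Fin.ext (by have := congrArg Fin.val hb'; exact this))), hr, hr, hv _ hb]
      · rw [h2 _ (fun b hb' => hi (by rw [hb']; exact (y b).2))]
        unfold pad
        rw [e1, e1', List.getD_append_right _ _ _ _ (by simpa using hi),
          List.getD_append_right _ _ _ _ (by simpa using hi), List.length_ofFn, List.length_ofFn]
    rw [key, evolve_reverse_evolve]

end Registers

/-! ### Simulation of a circuit whose oracle is computed from another oracle -/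

section Simulation

variable {M N n m n' m' : ℕ}

theorem pad_ofFn_castLE (h : M ≤ N) (u : Fin M → Bool) (a : Fin M) :
    pad N (List.ofFn u) (Fin.castLE h a) = u a := by
  simp [pad, List.getD_eq_getElem?_getD]

theorem pad_ofFn_of_le (u : Fin M → Bool) {i : Fin N} (hi : M ≤ i) :
    pad N (List.ofFn u) i = false :=
  List.getD_eq_default _ _ (by simpa using hi)

theorem update_pad (h : M ≤ N) (u : Fin M → Bool) (a : Fin M) (b : Bool) :
    Function.update (pad N (List.ofFn u)) (Fin.castLE h a) b =
      pad N (List.ofFn (Function.update u a b)) := by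
  funext i
  by_cases hi : (i : ℕ) < M
  · obtain ⟨j, rfl⟩ : ∃ j, i = Fin.castLE h j := ⟨⟨i, hi⟩, rfl⟩
    simp only [Function.update_apply, pad_ofFn_castLE, (Fin.castLE_injective h).eq_iff]
  · have hia : i ≠ Fin.castLE h a := by rintro rfl; exact hi a.2
    rw [Function.update_of_ne hia, pad_ofFn_of_le _ (not_lt.1 hi), pad_ofFn_of_le _ (not_lt.1 hi)]

theorem xorBit_pad (h : M ≤ N) (u : Fin M → Bool) (a : Fin M) (b : Bool) :
    xorBit (pad N (List.ofFn u)) (Fin.castLE h a) b = pad N (List.ofFn (xorBit u a b)) := by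
  rw [xorBit, pad_ofFn_castLE, update_pad, xorBit]

/-- The invariant concerns only the amplitudes of padded states. These are closed under the
pullbacks and bit updates that occur, so nothing has to be known about `ψ` elsewhere. -/
theorem exists_gate_simulation
    {f : ((Fin n → Bool) → (Fin m → Bool)) → (Fin n' → Bool) → (Fin m' → Bool)} {c : ℕ}
    (hf : Computes f c) (g : QGate M n' m') (hN : M + c < N) :
    ∃ gs : List (QGate N n m), gs.length ≤ 2 * c + m' + 1 ∧
      ∀ F (φ : QState M) (ψ : QState N), (∀ u, ψ (pad N (List.ofFn u)) = φ u) →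
        ∀ u, gs.foldl (fun ψ g => g.apply F ψ) ψ (pad N (List.ofFn u)) = g.apply (f F) φ u := by
  have h : M ≤ N := by omega
  have hinj := Fin.castLE_injective h
  cases g with
  | hadamard a =>
    refine ⟨[.hadamard (Fin.castLE h a)], by simp, fun F φ ψ hψ u => ?_⟩
    simp only [List.foldl_cons, List.foldl_nil, QGate.apply, update_pad, hψ, pad_ofFn_castLE]
  | phase a =>
    refine ⟨[.phase (Fin.castLE h a)], by simp, fun F φ ψ hψ u => ?_⟩
    simp only [List.foldl_cons, List.foldl_nil, QGate.apply, hψ, pad_ofFn_castLE]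
  | flip a =>
    refine ⟨[.flip (Fin.castLE h a)], by simp, fun F φ ψ hψ u => ?_⟩
    simp only [List.foldl_cons, List.foldl_nil, QGate.apply, xorBit_pad, hψ]
  | cnot a b hab =>
    refine ⟨[.cnot (Fin.castLE h a) (Fin.castLE h b) (hinj.ne hab)], by simp,
      fun F φ ψ hψ u => ?_⟩
    simp only [List.foldl_cons, List.foldl_nil, QGate.apply, xorBit_pad, hψ, pad_ofFn_castLE]
  | toffoli a b d had hbd =>
    refine ⟨[.toffoli (Fin.castLE h a) (Fin.castLE h b) (Fin.castLE h d) (hinj.ne had)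
      (hinj.ne hbd)], by simp, fun F φ ψ hψ u => ?_⟩
    simp only [List.foldl_cons, List.foldl_nil, QGate.apply, xorBit_pad, hψ, pad_ofFn_castLE]
  | oracle x y hxy =>
    obtain ⟨gs, hlen, hcl, hgs⟩ := hf.exists_gates x y hxy hN
    refine ⟨gs, by rw [Fintype.card_fin] at hlen; omega, fun F φ ψ hψ u => ?_⟩
    rw [foldl_apply_of_isClassical F hcl, hgs F u (xorQuery (f F) x y u)
      (fun w hw => xorQuery_apply_of_ne _ x y u hw) (fun b => xorQuery_apply _ x y u b), hψ]
    rfl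

theorem exists_simulation
    {f : ((Fin n → Bool) → (Fin m → Bool)) → (Fin n' → Bool) → (Fin m' → Bool)} {c : ℕ}
    (hf : Computes f c) (gs : List (QGate M n' m')) (hN : M + c < N) :
    ∃ gs' : List (QGate N n m), gs'.length ≤ gs.length * (2 * c + m' + 1) ∧
      ∀ F (φ : QState M) (ψ : QState N), (∀ u, ψ (pad N (List.ofFn u)) = φ u) →
        ∀ u, gs'.foldl (fun ψ g => g.apply F ψ) ψ (pad N (List.ofFn u)) =
          gs.foldl (fun φ g => g.apply (f F) φ) φ u := by
  induction gs with
  | nil => exact ⟨[], by simp, fun F φ ψ hψ u => hψ u⟩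
  | cons g gs ih =>
    obtain ⟨hs, h1, h2⟩ := exists_gate_simulation hf g hN
    obtain ⟨hs', h1', h2'⟩ := ih
    refine ⟨hs ++ hs', ?_, fun F φ ψ hψ u => ?_⟩
    · rw [List.length_append, List.length_cons, add_mul]
      omega
    · rw [List.foldl_append, List.foldl_cons]
      exact h2' F _ _ (h2 F φ ψ hψ) u

/-- Run the circuit `C` with the oracle `f F` computed from the oracle `F`, and return strings that
are computed from the strings returned by `C` and from `F`. -/
theorem exists_oracleCircuit (C : OracleCircuit n' m') {κ : Type*} [Fintype κ]
    {f : ((Fin n → Bool) → (Fin m → Bool)) → (Fin n' → Bool) → (Fin m' → Bool)} {c : ℕ}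
    (hf : Computes f c)
    {g : ((Fin n → Bool) → (Fin m → Bool)) → (Fin C.numOut × Fin n' → Bool) →
      (κ × Fin n → Bool)} {d : ℕ} (hg : Computes g d) :
    ∃ (D : OracleCircuit n m) (e : κ ≃ Fin D.numOut),
      D.size ≤ C.size * (2 * c + m' + 2) + 2 * (Fintype.card κ * n) + c + 3 * d + 1 +
        Fintype.card κ ∧
      ∀ F (P : (Fin C.numOut → Fin n' → Bool) → Prop) (Q : (κ → Fin n → Bool) → Prop),
        (∀ z, P z → Q fun k b => g F (fun i => z i.1 i.2) (k, b)) →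
        C.prob (f F) P ≤ D.prob F fun w => Q fun k => w (e k) := by
  classical
  set R := Fintype.card (κ × Fin n) with hR
  have hRc : R = Fintype.card κ * n := by simp [hR]
  set e := Fintype.equivFin κ
  set r := Fintype.equivFin (κ × Fin n)
  set N := C.wires + R + c + d + 1 with hNdef
  set y : κ × Fin n ↪ Fin (C.wires + R) := r.toEmbedding.trans (Fin.natAddEmb C.wires) with hy
  set x : Fin C.numOut × Fin n' → Fin (C.wires + R) := fun i => Fin.castAdd R (C.out i) with hx
  have hyv : ∀ b, (y b : ℕ) = C.wires + r b := fun _ => rfl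
  have hxy : ∀ a b, x a ≠ y b := fun a b hab => by
    have := congrArg Fin.val hab
    rw [hyv] at this
    have h2 : (x a : ℕ) < C.wires := (C.out a).2
    omega
  obtain ⟨gs, hgs, hsim⟩ := exists_simulation (N := N) hf C.gates (by omega)
  obtain ⟨hs, hhs, hcl, hpost⟩ := hg.exists_gates (N := N) x y hxy (by omega)
  have hMN : C.wires + R ≤ N := by omega
  set D : OracleCircuit n m :=
    { wires := N
      gates := gs ++ hs
      numOut := Fintype.card κ
      out := ((e.symm.prodCongr (Equiv.refl _)).toEmbedding.trans y).trans
        (Fin.castLEEmb hMN) } with hD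
  refine ⟨D, e, ?_, ?_⟩
  · have h1 : D.size = N + (gs ++ hs).length + Fintype.card κ := rfl
    have h2 : C.size * (2 * c + m' + 2) =
        C.gates.length * (2 * c + m' + 1) + C.gates.length +
          C.wires * (2 * c + m' + 1) + C.wires + C.numOut * (2 * c + m' + 2) := by
      simp only [OracleCircuit.size]; ring
    rw [h1, h2, List.length_append]
    omega
  intro F P Q hPQ
  set out : (Fin C.wires → Bool) → (Fin C.numOut × Fin n' → Bool) := fun u i => u (C.out i)
  set ext : (Fin C.wires → Bool) → (Fin (C.wires + R) → Bool) := fun u =>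
    Fin.append u fun i => g F (out u) (r.symm i) with hext
  -- `E u` is the basis state that `u` becomes after postprocessing: `u` itself, the computed
  -- strings, and clean scratch.
  set E : (Fin C.wires → Bool) → (Fin N → Bool) := fun u => pad N (List.ofFn (ext u)) with hE
  have hEu : ∀ u (a : Fin C.wires), E u (Fin.castLE (by omega) a) = u a := fun u a => by
    exact (pad_ofFn_castLE hMN (ext u) (Fin.castAdd R a)).trans (Fin.append_left _ _ a)
  have hEy : ∀ u b, E u (Fin.castLE hMN (y b)) = g F (out u) b := fun u b => by
    rw [hE]
    dsimp only
    rw [pad_ofFn_castLE, hext, hy]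
    simp
  have hEinj : Function.Injective E := fun u u' h => funext fun a => by
    rw [← hEu u a, h, hEu]
  have hamp : ∀ u, D.finalState F (E u) = C.finalState (f F) u := by
    intro u
    have h0 : D.finalState F (E u) = (gs ++ hs).foldl (fun ψ g => g.apply F ψ)
      (Pi.single (fun _ => false) 1) (E u) := rfl
    rw [h0, List.foldl_append, foldl_apply_of_isClassical F hcl,
      -- Pulling back through the postprocessing XORs the computed strings with themselves, which
      -- leaves 0 on their wires.
      hpost F (ext u) (Fin.append u fun _ => false) ?_ ?_]
    · have hpad : pad N (List.ofFn (Fin.append u fun _ : Fin R => false)) =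
          pad N (List.ofFn u) := by
        funext i
        by_cases hi : (i : ℕ) < C.wires
        · have h1 := pad_ofFn_castLE hMN (Fin.append u fun _ : Fin R => false)
            (Fin.castAdd R ⟨i, hi⟩)
          have h2 := pad_ofFn_castLE (N := N) (by omega) u ⟨i, hi⟩
          rw [Fin.append_left] at h1
          exact h1.trans h2.symm
        · rw [pad_ofFn_of_le u (not_lt.1 hi)]
          by_cases hi' : (i : ℕ) < C.wires + R
          · have h1 := pad_ofFn_castLE hMN (Fin.append u fun _ : Fin R => false)
              (Fin.natAdd C.wires ⟨i - C.wires, by omega⟩)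
            rw [Fin.append_right] at h1
            have hi2 : i = Fin.castLE hMN (Fin.natAdd C.wires ⟨i - C.wires, by omega⟩) :=
              Fin.ext (by change (i : ℕ) = C.wires + (i - C.wires); omega)
            rw [hi2]
            exact h1
          · exact pad_ofFn_of_le _ (not_lt.1 hi')
      rw [hpad]
      refine hsim F _ _ (fun v => ?_) u
      by_cases hv : v = fun _ => false
      · have : pad N (List.ofFn v) = fun _ => false := by
          funext i
          by_cases hi : (i : ℕ) < C.wires
          · rw [hv]
            exact pad_ofFn_castLE (N := N) (by omega) _ ⟨i, hi⟩
          · exact pad_ofFn_of_le _ (not_lt.1 hi)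
        rw [this, hv, Pi.single_eq_same, Pi.single_eq_same]
      · have : pad N (List.ofFn v) ≠ fun _ => false := fun h => hv <| by
          funext a
          rw [← pad_ofFn_castLE (N := N) (by omega) v a, h]
        rw [Pi.single_eq_of_ne this, Pi.single_eq_of_ne hv]
    · intro w hw
      refine Fin.addCases (fun a _ => ?_) (fun j hj => ?_) w hw
      · simp [hext]
      · exact absurd (by simp [hy]) (hj (r.symm j))
    · intro b
      have : (fun a => ext u (x a)) = out u := funext fun a => by simp [hext, hx, out]
      rw [this]
      simp [hext, hy]
  unfold OracleCircuit.prob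
  calc _ ≤ ∑ u, (fun s : Fin N → Bool =>
        if Q (fun k b => s (D.out (e k, b))) then ‖D.finalState F s‖ ^ 2 else 0) (E u) := by
        refine Finset.sum_le_sum fun u _ => ?_
        have hDo : ∀ k b, E u (D.out (e k, b)) = g F (out u) (k, b) := fun k b => by
          rw [← hEy]
          change E u (Fin.castLE hMN (y (e.symm (e k), b))) = _
          rw [e.symm_apply_apply]
        dsimp only
        rw [hamp]
        simp only [hDo]
        split_ifs with h1 h2 h2
        · exact le_rfl
        · exact absurd (hPQ _ h1) h2
        · positivity
        · exact le_rfl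
    _ = ∑ s ∈ Finset.univ.image E, (if Q (fun k b => s (D.out (e k, b)))
        then ‖D.finalState F s‖ ^ 2 else 0) := by
        rw [Finset.sum_image hEinj.injOn]
    _ ≤ _ := Finset.sum_le_univ_sum_of_nonneg fun s => by split_ifs <;> positivity

end Simulation

/-! ### Polynomial bounds -/

theorem eval_natPolynomial_mono (p : Polynomial ℕ) : Monotone fun x => p.eval x := fun a b h => by
  simp only [Polynomial.eval_eq_sum_range]
  gcongr

namespace PolylogBounded

variable {ι : Type*} {G H : ι → Type*} {f g : ι → ℕ}

theorem of_le (hg : PolylogBounded G g) (h : ∀ i, f i ≤ g i) : PolylogBounded G f := by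
  obtain ⟨p, hp⟩ := hg
  exact ⟨p, fun i => (h i).trans (hp i)⟩

theorem const (c : ℕ) : PolylogBounded G fun _ => c :=
  ⟨Polynomial.C c, fun i => by simp⟩

theorem add (hf : PolylogBounded G f) (hg : PolylogBounded G g) :
    PolylogBounded G fun i => f i + g i := by
  obtain ⟨p, hp⟩ := hf
  obtain ⟨q, hq⟩ := hg
  exact ⟨p + q, fun i => by rw [Polynomial.eval_add]; exact add_le_add (hp i) (hq i)⟩

theorem mul (hf : PolylogBounded G f) (hg : PolylogBounded G g) :
    PolylogBounded G fun i => f i * g i := by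
  obtain ⟨p, hp⟩ := hf
  obtain ⟨q, hq⟩ := hg
  exact ⟨p * q, fun i => by rw [Polynomial.eval_mul]; exact Nat.mul_le_mul (hp i) (hq i)⟩

/-- Polynomials compose, and those with natural coefficients are monotone. -/
theorem change (hG : PolylogBounded H fun i => Nat.log 2 (Nat.card (G i)))
    (hf : PolylogBounded G f) : PolylogBounded H f := by
  obtain ⟨q, hq⟩ := hG
  obtain ⟨p, hp⟩ := hf
  exact ⟨p.comp q, fun i => by
    rw [Polynomial.eval_comp]
    exact (hp i).trans (eval_natPolynomial_mono p (hq i))⟩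

theorem log_self : PolylogBounded G fun i => Nat.log 2 (Nat.card (G i)) :=
  ⟨Polynomial.X, fun i => by simp⟩

end PolylogBounded

theorem OracleCircuit.prob_mono {n m : ℕ} (C : OracleCircuit n m)
    (F : (Fin n → Bool) → (Fin m → Bool)) {P Q : (Fin C.numOut → Fin n → Bool) → Prop}
    (h : ∀ z, P z → Q z) : C.prob F P ≤ C.prob F Q := by
  unfold OracleCircuit.prob
  refine Finset.sum_le_sum fun s _ => ?_
  split_ifs with h1 h2 h2
  · exact le_rfl
  · exact absurd (h _ h1) h2
  · positivity
  · exact le_rfl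

/-! ### Reduction of a hidden subgroup problem to a quotient -/

section Reduction

variable {G H : Type*} [Group G] [Group H] (π : G →* H)

/-- Generators of the image of `L` lift, together with `L ⊓ ker π`, to generators of `L`. -/
theorem closure_eq_of_lifts (L : Subgroup G) {S : Set G} (hSL : S ⊆ L)
    (hker : ∀ k ∈ L, π k = 1 → k ∈ S) {T : Set H} (hT : Subgroup.closure T = L.map π)
    (hlift : ∀ h ∈ T, ∃ s ∈ S, π s = h) : Subgroup.closure S = L := by
  refine le_antisymm ((Subgroup.closure_le _).2 hSL) fun l hl => ?_
  have hTS : Subgroup.closure T ≤ (Subgroup.closure S).map π := by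
    rw [Subgroup.closure_le]
    intro h hh
    obtain ⟨s, hs, rfl⟩ := hlift h hh
    exact Subgroup.mem_map_of_mem _ (Subgroup.subset_closure hs)
  obtain ⟨s, hs, hsl⟩ := hTS (hT ▸ Subgroup.mem_map_of_mem π hl)
  have hs' : s ∈ L := (Subgroup.closure_le _).2 hSL hs
  -- The elements `s` and `l` of `L` have the same image, so they differ by an element of `L ⊓ ker
  -- π`, all of which lies in `S`.
  have : s⁻¹ * l ∈ S := hker _ (L.mul_mem (L.inv_mem hs') hl) (by rw [map_mul, map_inv, hsl]; simp)
  simpa using (Subgroup.closure S).mul_mem hs (Subgroup.subset_closure this)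

/-- The least label on the cosets in a preimage hides the image of the hidden subgroup. -/
theorem hides_map {K : Subgroup G} (hπ : ∀ g, π g = 1 ↔ g ∈ K) (eG : BinEncoding G) (eH : BinEncoding H) {m : ℕ} [Fintype K]
    {F : (Fin eG.len → Bool) → (Fin m → Bool)} {L : Subgroup G} (hF : Hides eG F L) {t : H → G}
    (ht : ∀ h, π (t h) = h) {F' : (Fin eH.len → Bool) → (Fin m → Bool)}
    (hF' : ∀ h, F' (eH.code h) = familyMin 1 fun k : K => F (eG.code (t h * k))) :
    Hides eH F' (L.map π) := by
  have hK : ∀ k : K, π k = 1 := fun k => (hπ k).2 k.2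
  have key : ∀ h h' : H, h⁻¹ * h' ∈ L.map π → ∀ k : K, ∃ k' : K,
      F (eG.code (t h * k)) = F (eG.code (t h' * k')) := by
    rintro h h' ⟨l, hl, hlh⟩ k
    -- Right multiplication by `l` stays in the same left coset of `L` and moves the fibre over `h`
    -- to the fibre over `h'`.
    refine ⟨⟨(t h')⁻¹ * (t h * k * l), (hπ _).1 ?_⟩, (hF _ _).2 ?_⟩
    · simp [ht, hK, hlh]
    · simpa [mul_assoc] using hl
  intro h h'
  rw [hF', hF']
  refine ⟨fun e => ?_, fun hh => ?_⟩
  · obtain ⟨k, hk⟩ := familyMin_mem 1 fun k : K => F (eG.code (t h * k))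
    obtain ⟨k', hk'⟩ := familyMin_mem 1 fun k : K => F (eG.code (t h' * k))
    rw [hk, hk'] at e
    have := Subgroup.mem_map_of_mem π ((hF _ _).1 e)
    simpa [ht, hK] using this
  · refine familyMin_congr 1 (key h h' hh) (key h' h ?_)
    simpa using (L.map π).inv_mem hh

/-- There is a transversal that maps each coset to its element with the least code. -/
theorem exists_min_transversal {K : Subgroup G} (hπ : ∀ g, π g = 1 ↔ g ∈ K)
    (eG : BinEncoding G) [Fintype K]
    (hsurj : Function.Surjective π) : ∃ t : H → G, (∀ h, π (t h) = h) ∧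
      ∀ g, (familyMin 1 fun k : K => eG.code (g * k)) = eG.code (t (π g)) := by
  have hK : ∀ k : K, π k = 1 := fun k => (hπ k).2 k.2
  have : ∀ h, ∃ k : K, (familyMin 1 fun k : K => eG.code (Function.surjInv hsurj h * k)) =
      eG.code (Function.surjInv hsurj h * k) := fun h => familyMin_mem 1 _
  choose k hk using this
  refine ⟨fun h => Function.surjInv hsurj h * k h, fun h => ?_, fun g => ?_⟩
  · rw [map_mul, hK, mul_one, Function.surjInv_eq hsurj]
  · rw [← hk]
    have hg := Function.surjInv_eq hsurj (π g)
    refine familyMin_congr 1 (fun k => ?_) (fun k => ?_)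
    · refine ⟨⟨(Function.surjInv hsurj (π g))⁻¹ * (g * k), (hπ _).1 ?_⟩, by simp⟩
      simp [hg, hK]
    · refine ⟨⟨g⁻¹ * (Function.surjInv hsurj (π g) * k), (hπ _).1 ?_⟩, by simp⟩
      simp [hg, hK]

/-- Multiplication by a fixed element. -/
theorem computes_mul_const {n m : ℕ} {l : ℕ} (C : BoolCircuit (l + l) l) (v : Fin l → Bool) :
    Computes (n := n) (m := m) (fun _ x => C.eval (Fin.append x v)) (2 * C.size + 8) := by
  have h := (Computes.circuit (n := n) (m := m) C).comp
    ((Computes.rewire (finSumFinEquiv.symm : Fin (l + l) → Fin l ⊕ Fin l)).comp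
      ((Computes.rewire (id : Fin l → Fin l)).pair (Computes.const v)))
  refine h.of_eq (fun F x => ?_) (by omega)
  congr 1
  funext i
  refine Fin.addCases (fun j => ?_) (fun j => ?_) i
  · rw [finSumFinEquiv_symm_apply_castAdd, Fin.append_left]
    rfl
  · rw [finSumFinEquiv_symm_apply_natAdd, Fin.append_right]
    rfl

end Reduction

/-! ### The circuit for the extension and its correctness. -/

section Reduction

variable {G H : Type*} [Group G] [Group H]

/-- The cost of computing a label of the quotient, and of lifting a string returned for it. -/
def reductionCost (κ len m sM sT : ℕ) : ℕ :=
  (κ + 1) * (2 * sT + 2 * sM + 120 * m + 9 * len + 100)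

theorem computes_quotient_label {n m k : ℕ} {κ : Type*} [Fintype κ] (k₀ : κ)
    (CM : BoolCircuit (n + n) n) (CT : BoolCircuit k n) (code : κ → Fin n → Bool) :
    Computes (fun (F : (Fin n → Bool) → (Fin m → Bool)) (x : Fin k → Bool) =>
      familyMin k₀ fun a => F (CM.eval (Fin.append (CT.eval x) (code a))))
      (reductionCost (Fintype.card κ) n m CM.size CT.size) := by
  refine (Computes.familyMin k₀ fun a => Computes.query.comp
    ((computes_mul_const CM (code a)).comp (Computes.circuit CT))).mono ?_
  simp only [Fintype.card_fin]
  rw [reductionCost, add_mul, one_mul]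
  exact Nat.add_le_add (Nat.mul_le_mul_left _ (by omega)) (by omega)

/-- For a string `z j` of the quotient, lift it and multiply the lift by `a`. -/
def liftCandidate {n k r : ℕ} {κ : Type*} (CM : BoolCircuit (n + n) n) (CT : BoolCircuit k n)
    (code : κ → Fin n → Bool) (z : Fin r × Fin k → Bool) : Option (Fin r) × κ → Fin n → Bool
  | (none, a) => code a
  | (some j, a) => CM.eval (Fin.append (CT.eval fun b => z (j, b)) (code a))

/-- Keep the candidates that carry the label of the identity. -/
noncomputable def filteredLifts {n m k r : ℕ} {κ : Type*} (CM : BoolCircuit (n + n) n)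
    (CT : BoolCircuit k n) (code : κ → Fin n → Bool) (one : Fin n → Bool)
    (F : (Fin n → Bool) → (Fin m → Bool)) (z : Fin r × Fin k → Bool)
    (i : Option (Fin r) × κ) : Fin n → Bool :=
  if strEq (F (liftCandidate CM CT code z i)) (F one) then liftCandidate CM CT code z i else one

/-- Each candidate is computed twice, once for the test and once for the output, which doubles the
contributions of `CT` and `CM`. There are `r + 1` groups of candidates: one for each returned string
and one for the kernel itself. -/
theorem computes_filteredLifts {n m k r : ℕ} {κ : Type*} [Fintype κ] (CM : BoolCircuit (n + n) n)
    (CT : BoolCircuit k n) (code : κ → Fin n → Bool) (one : Fin n → Bool) :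
    Computes (fun (F : (Fin n → Bool) → (Fin m → Bool)) (z : Fin r × Fin k → Bool)
      (ib : (Option (Fin r) × κ) × Fin n) => filteredLifts CM CT code one F z ib.1 ib.2)
      ((r + 1) * Fintype.card κ * (4 * CT.size + 4 * CM.size + 98 * m + 10 * n + 200)) := by
  have hcand : ∀ i, Computes (n := n) (m := m)
      (fun _ z => liftCandidate CM CT code (r := r) z i) (2 * CT.size + 2 * CM.size + 12) := by
    rintro ⟨_ | j, a⟩
    · exact (Computes.const (code a)).mono (by omega)
    · exact ((computes_mul_const CM (code a)).comp ((Computes.circuit CT).comp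
        (Computes.rewire fun b => (j, b)))).mono (by omega)
  refine (Computes.family fun i => ((Computes.query.comp (hcand i)).strEq
    (Computes.query.comp (Computes.const one))).mux (hcand i) (Computes.const one)).mono ?_
  rw [Fintype.card_prod, Fintype.card_option, Fintype.card_fin, Fintype.card_fin, Fintype.card_fin]
  exact Nat.mul_le_mul_left _ (by omega)

/-- A bound for the size of the circuit that solves the hidden subgroup problem of a group by
means of one for its quotient. -/
def reductionSize (κ len m sM sT sC : ℕ) : ℕ :=
  sC * (2 * reductionCost κ len m sM sT + m + 2) + 2 * ((sC + 1) * κ * len) +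
    reductionCost κ len m sM sT +
    3 * ((sC + 1) * κ * (4 * sT + 4 * sM + 98 * m + 10 * len + 200)) + 1 + (sC + 1) * κ

/-- The postprocessing is deterministic and succeeds whenever `C` returns generators of the image of
`L`, so no success probability is lost. Values of the derived oracle on strings that encode no
element are harmless, since hiding does not constrain them. -/
theorem exists_solvesHSP (π : G →* H) {K : Subgroup G} [Finite K] (hπ : ∀ g, π g = 1 ↔ g ∈ K)
    (eG : BinEncoding G) (eH : BinEncoding H) {m : ℕ}
    (CM : BoolCircuit (eG.len + eG.len) eG.len)
    (hCM : ∀ x y, CM.eval (Fin.append (eG.code x) (eG.code y)) = eG.code (x * y))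
    (CT : BoolCircuit eH.len eG.len) {t : H → G} (ht : ∀ h, π (t h) = h)
    (hCT : ∀ h, CT.eval (eH.code h) = eG.code (t h))
    (C : OracleCircuit eH.len m) (hC : SolvesHSP eH C) :
    ∃ D : OracleCircuit eG.len m,
      D.size ≤ reductionSize (Nat.card K) eG.len m CM.size CT.size C.size ∧ SolvesHSP eG D := by
  have := Fintype.ofFinite K
  have hK : ∀ k : K, π k = 1 := fun k => (hπ k).2 k.2
  have hr : C.numOut ≤ C.size := by simp only [OracleCircuit.size]; omega
  obtain ⟨D, e, hD, hprob⟩ := exists_oracleCircuit C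
    (computes_quotient_label (m := m) (1 : K) CM CT fun k => eG.code k)
    (computes_filteredLifts (m := m) CM CT (fun k : K => eG.code k) (eG.code 1))
  refine ⟨D, hD.trans ?_, fun L F hF => ?_⟩
  · simp only [Fintype.card_prod, Fintype.card_option, Fintype.card_fin, reductionSize,
      Nat.card_eq_fintype_card]
    gcongr
  have hH := hides_map π hπ eG eH hF ht (F' := fun x =>
    familyMin 1 fun k : K => F (CM.eval (Fin.append (CT.eval x) (eG.code k))))
    fun h => by simp only [hCT, hCM]
  refine (hC _ _ hH).trans ((hprob F _ (fun w => ∃ g : _ → G, (∀ i, eG.code (g i) = w i) ∧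
    Subgroup.closure (Set.range g) = L) ?_).trans (D.prob_mono F ?_))
  · rintro z ⟨h, hz, hcl⟩
    set z' : Fin C.numOut × Fin eH.len → Bool := fun i => z i.1 i.2
    set cand : Option (Fin C.numOut) × K → G := fun i =>
      (match i.1 with
        | none => 1
        | some j => t (h j)) * i.2 with hcand
    have hcode : ∀ i, liftCandidate CM CT (fun k : K => eG.code k) z' i = eG.code (cand i) := by
      rintro ⟨_ | j, k⟩
      · simp [liftCandidate, hcand]
      · have : (fun b => z' (j, b)) = eH.code (h j) := (hz j).symm
        simp only [liftCandidate, this, hCT, hCM, hcand]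
    classical
    -- Membership in `L` is visible from the oracle: `L` is the left coset of 1.
    have hmem : ∀ i, F (eG.code (cand i)) = F (eG.code 1) ↔ cand i ∈ L := fun i => by
      rw [eq_comm, hF]; simp
    refine ⟨fun i => if cand i ∈ L then cand i else 1, fun i => ?_, ?_⟩
    · have : filteredLifts CM CT (fun k : K => eG.code k) (eG.code 1) F z' i =
          eG.code (if cand i ∈ L then cand i else 1) := by
        simp only [filteredLifts, hcode, strEq_eq_true_iff, hmem]
        split_ifs <;> rfl
      exact this.symm
    · refine closure_eq_of_lifts π L ?_ ?_ hcl ?_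
      · rintro _ ⟨i, rfl⟩
        dsimp only
        split_ifs with hi
        · exact hi
        · exact L.one_mem
      · intro k hkL hk
        refine ⟨(none, ⟨k, (hπ k).1 hk⟩), ?_⟩
        have : cand (none, ⟨k, (hπ k).1 hk⟩) = k := by simp [hcand]
        simp only [this, if_pos hkL]
      · rintro _ ⟨j, rfl⟩
        have hj : h j ∈ L.map π := hcl ▸ Subgroup.subset_closure ⟨j, rfl⟩
        obtain ⟨l, hl, hlj⟩ := hj
        -- Any lift `l` of `h j` in `L` differs from the transversal element by some `k` in `K`, so
        -- it occurs among the candidates and passes the test.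
        have hk : (t (h j))⁻¹ * l ∈ K := (hπ _).1 (by simp [ht, hlj])
        have hc : cand (some j, ⟨_, hk⟩) = l := by simp [hcand]
        refine ⟨l, ⟨(some j, ⟨_, hk⟩), ?_⟩, hlj⟩
        simp only [hc]
        exact if_pos hl
  · rintro w ⟨g, hg, hcl⟩
    refine ⟨g ∘ e.symm, fun j => ?_, ?_⟩
    · rw [Function.comp_apply, hg]
      exact congrArg w (e.apply_symm_apply j)
    · rw [Set.range_comp, e.symm.range_eq_univ, Set.image_univ, hcl]

/-- The projection to a group that is identified with a quotient. -/
def quotientProj (K : Subgroup G) [K.Normal] (φ : G ⧸ K ≃* H) : G →* H :=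
  φ.toMonoidHom.comp (QuotientGroup.mk' K)

theorem quotientProj_eq_one_iff (K : Subgroup G) [K.Normal] (φ : G ⧸ K ≃* H) (g : G) :
    quotientProj K φ g = 1 ↔ g ∈ K := by
  simp [quotientProj]

theorem quotientProj_surjective (K : Subgroup G) [K.Normal] (φ : G ⧸ K ≃* H) :
    Function.Surjective (quotientProj K φ) :=
  φ.surjective.comp (QuotientGroup.mk'_surjective K)

/-- The quotient is encoded by the least codes of the elements of the cosets. -/
theorem exists_quotient_encoding (π : G →* H) {K : Subgroup G} [Finite K]
    (hπ : ∀ g, π g = 1 ↔ g ∈ K) (hsurj : Function.Surjective π) (eG : BinEncoding G)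
    (CM : BoolCircuit (eG.len + eG.len) eG.len)
    (hCM : ∀ x y, CM.eval (Fin.append (eG.code x) (eG.code y)) = eG.code (x * y)) :
    ∃ (eH : BinEncoding H) (t : H → G) (C : BoolCircuit (eH.len + eH.len) eH.len)
      (CT : BoolCircuit eH.len eG.len), eH.len = eG.len ∧ (∀ h, π (t h) = h) ∧
      C.size ≤ reductionCost (Nat.card K) eG.len eG.len CM.size CM.size ∧
      (∀ x y, C.eval (Fin.append (eH.code x) (eH.code y)) = eH.code (x * y)) ∧
      CT.size = 0 ∧ ∀ h, CT.eval (eH.code h) = eG.code (t h) := by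
  have := Fintype.ofFinite K
  obtain ⟨t, ht, hmin⟩ := exists_min_transversal π hπ eG hsurj
  obtain ⟨C, hC, hCeval⟩ := (Computes.familyMin (n := 0) (m := 0) (1 : K) fun k =>
    (computes_mul_const CM (eG.code k)).comp (Computes.circuit CM)).exists_boolCircuit
  -- Since `h` carries the very code of `t h`, the transversal circuit just outputs its input.
  refine ⟨⟨eG.len, fun h => eG.code (t h), eG.code_injective.comp
    (Function.LeftInverse.injective ht)⟩, t, C, ⟨[], fun j => j⟩, rfl, ht, hC.trans ?_,
    fun x y => ?_, rfl, fun h => ?_⟩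
  · simp only [Fintype.card_fin]
    rw [reductionCost, add_mul, one_mul, Nat.card_eq_fintype_card]
    exact Nat.add_le_add (Nat.mul_le_mul_left _ (by omega)) (by omega)
  · refine (hCeval id _).trans ?_
    simp only [hCM]
    -- The least code in the coset of `t x * t y` is that of `t (x * y)`.
    rw [hmin, map_mul, ht, ht]
  · funext j
    simp [BoolCircuit.eval, BoolCircuit.wires, List.getD_eq_getElem?_getD]

end Reduction

/-! ### Polynomial bounds and passage to families. -/

section Families

variable {ι : Type*} {G H : ι → Type*}

theorem PolylogBounded.reductionCost {κ len m sM sT : ι → ℕ} (hκ : PolylogBounded G κ)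
    (hlen : PolylogBounded G len) (hm : PolylogBounded G m) (hM : PolylogBounded G sM)
    (hT : PolylogBounded G sT) :
    PolylogBounded G fun i => _root_.reductionCost (κ i) (len i) (m i) (sM i) (sT i) :=
  (hκ.add (const 1)).mul ((((((const 2).mul hT).add ((const 2).mul hM)).add
    ((const 120).mul hm)).add ((const 9).mul hlen)).add (const 100))

theorem PolylogBounded.reductionSize {κ len m sM sT sC : ι → ℕ} (hκ : PolylogBounded G κ)
    (hlen : PolylogBounded G len) (hm : PolylogBounded G m) (hM : PolylogBounded G sM)
    (hT : PolylogBounded G sT) (hC : PolylogBounded G sC) :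
    PolylogBounded G fun i =>
      _root_.reductionSize (κ i) (len i) (m i) (sM i) (sT i) (sC i) := by
  have hc := hκ.reductionCost hlen hm hM hT
  have hk := (hC.add (const 1)).mul hκ
  exact (((((hC.mul ((((const 2).mul hc).add hm).add (const 2))).add
    ((const 2).mul (hk.mul hlen))).add hc).add ((const 3).mul (hk.mul
      ((((((const 4).mul hT).add ((const 4).mul hM)).add ((const 98).mul hm)).add
        ((const 10).mul hlen)).add (const 200))))).add (const 1)).add hk

variable [∀ i, Group (G i)] [∀ i, Group (H i)] [∀ i, Finite (G i)]

theorem polylogBounded_log_quotient (K : ∀ i, Subgroup (G i)) [∀ i, (K i).Normal]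
    (φ : ∀ i, G i ⧸ K i ≃* H i) : PolylogBounded G fun i => Nat.log 2 (Nat.card (H i)) :=
  PolylogBounded.log_self.of_le fun i => Nat.log_mono_right <| by
    rw [← Nat.card_congr (φ i).toEquiv]
    exact Nat.card_le_card_of_surjective _ (QuotientGroup.mk_surjective (s := K i))

/-- The crude estimate |K| < 2^|K| gives log |G| ≤ |K| + log |H| + 1, which suffices because |K|
itself is polynomial in log |H|. -/
theorem polylogBounded_log_extension (K : ∀ i, Subgroup (G i)) [∀ i, (K i).Normal]
    (φ : ∀ i, G i ⧸ K i ≃* H i)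
    (hK : PolylogBounded H fun i => Nat.card (K i)) :
    PolylogBounded H fun i => Nat.log 2 (Nat.card (G i)) := by
  refine ((hK.add PolylogBounded.log_self).add (PolylogBounded.const 1)).of_le fun i => ?_
  have h1 : Nat.card (G i) = Nat.card (H i) * Nat.card (K i) := by
    rw [← Nat.card_congr (φ i).toEquiv]
    exact Subgroup.card_eq_card_quotient_mul_card_subgroup _
  have h2 : Nat.card (H i) < 2 ^ (Nat.log 2 (Nat.card (H i)) + 1) :=
    Nat.lt_pow_succ_log_self one_lt_two _
  have h3 : Nat.card (K i) < 2 ^ Nat.card (K i) := Nat.lt_two_pow_self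
  have h4 : Nat.card (G i) < 2 ^ (Nat.card (K i) + (Nat.log 2 (Nat.card (H i)) + 1)) := by
    rw [h1, mul_comm, pow_add]
    exact Nat.mul_lt_mul'' h3 h2
  have := Nat.log_lt_of_lt_pow Nat.card_pos.ne' h4
  omega

theorem fullyReconstructibleIn_of_quotient (K : ∀ i, Subgroup (G i)) [∀ i, (K i).Normal]
    (φ : ∀ i, G i ⧸ K i ≃* H i)
    (hK : PolylogBounded H fun i => Nat.card (K i))
    (eH : ∀ i, BinEncoding (H i)) (eG : ∀ i, BinEncoding (G i)) (heG : EfficientlyEncoded G eG)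
    (ht : EfficientTransversal K φ eH eG) (h : FullyReconstructibleIn H eH) :
    FullyReconstructibleIn G eG := by
  have hHG := polylogBounded_log_quotient K φ
  have hGH := polylogBounded_log_extension K φ hK
  obtain ⟨hlen, CM, hCMs, hCM⟩ := heG
  obtain ⟨t, ht, CT, hCTs, hCT⟩ := ht
  intro m hm
  -- A minimum of labels is again a label, so the quotient problem has the same label length `m`.
  obtain ⟨C, hCs, hC⟩ := h m (.change hGH hm)
  choose D hDs hD using fun i => exists_solvesHSP (quotientProj (K i) (φ i))
    (quotientProj_eq_one_iff (K i) (φ i)) (eG i) (eH i) (CM i) (hCM i) (CT i) (ht i) (hCT i) (C i) (hC i)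
  exact ⟨D, (PolylogBounded.reductionSize (.change hHG hK) hlen hm hCMs hCTs
    (.change hHG hCs)).of_le hDs, hD⟩

/-- The assumption on `H` covers every efficient encoding, so it may be applied to the one by least
codes in cosets. Efficiency of that encoding must be measured in log |H|, and smallness of `K` makes
this possible. -/
theorem fullyReconstructible_of_quotient (K : ∀ i, Subgroup (G i)) [∀ i, (K i).Normal]
    (φ : ∀ i, G i ⧸ K i ≃* H i)
    (hK : PolylogBounded H fun i => Nat.card (K i))
    (h : FullyReconstructible H) : FullyReconstructible G := by
  have hHG := polylogBounded_log_quotient K φ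
  have hGH := polylogBounded_log_extension K φ hK
  intro eG heG
  obtain ⟨hlen, CM, hCMs, hCM⟩ := id heG
  choose eH t C CT hl ht hCs hC hCTs hCT using fun i => exists_quotient_encoding
    (quotientProj (K i) (φ i)) (quotientProj_eq_one_iff (K i) (φ i)) (quotientProj_surjective (K i) (φ i)) (eG i)
    (CM i) (hCM i)
  refine fullyReconstructibleIn_of_quotient K φ hK eH eG heG
    ⟨t, ht, CT, (PolylogBounded.const 0).of_le fun i => (hCTs i).le, hCT⟩ (h eH ⟨?_, C, ?_, hC⟩)
  · exact (PolylogBounded.change hGH hlen).of_le fun i => (hl i).le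
  · exact (hK.reductionCost (.change hGH hlen) (.change hGH hlen) (.change hGH hCMs)
      (.change hGH hCMs)).of_le hCs

end Families

theorem theorem5 {ι : Type*} {G H : ι → Type*} [∀ i, Group (G i)] [∀ i, Group (H i)]
    [∀ i, Finite (G i)]
    (K : ∀ i, Subgroup (G i)) [∀ i, (K i).Normal] (φ : ∀ i, G i ⧸ K i ≃* H i)
    (hK : PolylogBounded H (fun i => Nat.card (K i))) :
    (FullyReconstructible H → FullyReconstructible G) ∧
    (∀ (eH : ∀ i, BinEncoding (H i)) (eG : ∀ i, BinEncoding (G i)),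
      PolylogBounded H (fun i => (eH i).len) → EfficientlyEncoded G eG →
      EfficientTransversal K φ eH eG →
      FullyReconstructibleIn H eH → FullyReconstructibleIn G eG) :=
  ⟨fullyReconstructible_of_quotient K φ hK, fun eH eG _ heG ht h =>
    fullyReconstructibleIn_of_quotient K φ hK eH eG heG ht h⟩
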